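/- Let $R=\bigoplus_{n\in\mathbb Z}R_n$ be a $\mathbb Z$-graded (associative, unital, not necessarily commutative) ring. A module is \emph{pure-projective} if it is isomorphic to a direct summand of a direct sum of finitely presented modules, and $R$ is \emph{right} (respectively \emph{left}) \emph{pure-semisimple} if every right (respectively left) $R$-module is pure-projective. A right $R$-module $N$ is \emph{gradable} if it is isomorphic, as an $R$-module, to the underlying module of a $\mathbb Z$-graded right $R$-module, i.e. of a right $R$-module $M$ with a decomposition $M=\bigoplus_{n\in\mathbb Z}M_n$ into additive subgroups such that $M_iR_j\subseteq M_{i+j}$ for all $i,j\in\mathbb Z$; gradable left modules are defined in the same way, with $R_iM_j\subseteq M_{i+j}$. If $R$ is right pure-semisimple or left pure-semisimple, then every finitely presented right $R$-module and every finitely presented left $R$-module is gradable. Moreover, if $R$ is right pure-semisimple, then every finitely generated right $R$-module is gradable. -/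

import Mathlib

open scoped DirectSum

universe u v

/-- A module `M` over a (not necessarily commutative) ring `S` is pure-projective if it is
isomorphic to a direct summand of a direct sum of finitely presented modules. -/
def IsPureProjective (S : Type u) [Ring S] (M : Type u) [AddCommGroup M] [Module S M] : Prop :=
  ∃ (ι : Type u) (F : ι → Type u) (_ : ∀ i, AddCommGroup (F i)) (_ : ∀ i, Module S (F i))
    (K : Type u) (_ : AddCommGroup K) (_ : Module S K),
    (∀ i, Module.FinitePresentation S (F i)) ∧ Nonempty ((M × K) ≃ₗ[S] ⨁ i, F i)

/-- `R` is left pure-semisimple if every left `R`-module is pure-projective. -/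
def IsLeftPureSemisimple (R : Type u) [Ring R] : Prop :=
  ∀ (M : Type u) [AddCommGroup M] [Module R M], IsPureProjective R M

/-- `R` is right pure-semisimple if every right `R`-module (that is, every module over the
opposite ring) is pure-projective. -/
def IsRightPureSemisimple (R : Type u) [Ring R] : Prop :=
  ∀ (M : Type u) [AddCommGroup M] [Module Rᵐᵒᵖ M], IsPureProjective Rᵐᵒᵖ M

/-- `ℳ` is a grading of the left module `M` over the ring `R` graded by `𝒜`: `M` is the direct
sum of its additive subgroups `ℳ n`, and `R_i M_j ⊆ M_{i+j}`. -/
structure IsLeftModuleGrading {R : Type u} [Ring R] (𝒜 : ℤ → AddSubgroup R)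
    {M : Type v} [AddCommGroup M] [Module R M] (ℳ : ℤ → AddSubgroup M) : Prop where
  isInternal : DirectSum.IsInternal ℳ
  smul_mem : ∀ (i j : ℤ) (r : R) (m : M), r ∈ 𝒜 i → m ∈ ℳ j → r • m ∈ ℳ (i + j)

/-- `ℳ` is a grading of the right module `M` over the ring `R` graded by `𝒜`: `M` is the direct
sum of its additive subgroups `ℳ n`, and `M_i R_j ⊆ M_{i+j}`. -/
structure IsRightModuleGrading {R : Type u} [Ring R] (𝒜 : ℤ → AddSubgroup R)
    {M : Type v} [AddCommGroup M] [Module Rᵐᵒᵖ M] (ℳ : ℤ → AddSubgroup M) : Prop where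
  isInternal : DirectSum.IsInternal ℳ
  smul_mem : ∀ (i j : ℤ) (m : M) (r : R), m ∈ ℳ i → r ∈ 𝒜 j →
    MulOpposite.op r • m ∈ ℳ (i + j)

/-- A left `R`-module is gradable if it is isomorphic, as an ungraded module, to the underlying
module of a graded left `R`-module. -/
def IsLeftGradable {R : Type u} [Ring R] (𝒜 : ℤ → AddSubgroup R)
    (N : Type v) [AddCommGroup N] [Module R N] : Prop :=
  ∃ (M : Type v) (_ : AddCommGroup M) (_ : Module R M) (ℳ : ℤ → AddSubgroup M),
    IsLeftModuleGrading 𝒜 ℳ ∧ Nonempty (N ≃ₗ[R] M)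

/-- A right `R`-module is gradable if it is isomorphic, as an ungraded module, to the underlying
module of a graded right `R`-module. -/
def IsRightGradable {R : Type u} [Ring R] (𝒜 : ℤ → AddSubgroup R)
    (N : Type v) [AddCommGroup N] [Module Rᵐᵒᵖ N] : Prop :=
  ∃ (M : Type v) (_ : AddCommGroup M) (_ : Module Rᵐᵒᵖ M) (ℳ : ℤ → AddSubgroup M),
    IsRightModuleGrading 𝒜 ℳ ∧ Nonempty (N ≃ₗ[Rᵐᵒᵖ] M)

-- Work on the left and write `N[t, t⁻¹]` for `Laurent g N`: it is graded by the exponent of `t`,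
-- and a homogeneous scalar `r` of degree `j` sends `n t ^ i` to `(r n) t ^ (i + j)`. Graded pieces
-- are split off `N[t, t⁻¹]` and then transported to `N` along `t = 1`.
--
-- Pure-semisimplicity is used twice. First, it makes the ring left artinian: cyclic modules are
-- finitely presented, so the ring is left noetherian; telescopes of right multiplications give the
-- descending chain condition on principal right ideals; noetherian induction over two-sided ideals
-- combines the two (`isArtinianRing_of_dcc`). Second, `N[t, t⁻¹]` is pure-projective, so each of
-- its elements is fixed by an endomorphism with range in a finitely generated submodule
-- (`LocallyFixed`). The degree-zero part of such an endomorphism and Fitting's lemma give a nonzero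
-- finitely generated graded summand, hence a graded-indecomposable one `Y`, of finite length and
-- finite support (`exists_support`).
--
-- Let `f` and `p` be the inclusion of `Y` and the projection to it. The composite of `f` with
-- evaluation at `t = 1`, followed by `n ↦ ∑ i, p (n t ^ i)`, is the sum of the maps `p t ^ k f`.
-- The term for `k = 0` is the identity. The others are homogeneous of nonzero degree, hence not
-- injective, and a graded Harada-Sai lemma makes their sum nilpotent. The composite is thus
-- invertible and `Y` is a summand of `N` (`Laurent.exists_retraction`); induction on the length of
-- `N` finishes. The argument needs only an artinian ring and local fixedness, so it also shows that
-- summands of finitely generated gradable modules are gradable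
-- (`RingZGrading.Gradable.of_retract`).
--
-- Finitely presented modules on the other side are cokernels of duals of maps between finitely
-- generated free modules. Such a map must be made homogeneous. It is a retract of the sum of a
-- graded projective presentation of its cokernel and trivial maps (`exists_grading_of_projective`);
-- since maps are modules over a triangular matrix ring, the result on summands supplies the
-- gradings. Dualizing then grades the given module (`gradable_of_antiEquiv`).

universe w

/-! ### Left noetherian rings with descending chains on principal right ideals -/

section Chase

theorem isArtinian_of_surjective_ringHom {R S M : Type*} [Ring R] [Ring S] [AddCommGroup M]
    [Module R M] [Module S M] (f : R →+* S) (hf : Function.Surjective f)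
    (h : ∀ (r : R) (m : M), f r • m = r • m) [IsArtinian S M] : IsArtinian R M := by
  let F : Submodule R M → Submodule S M := fun p =>
    { p with
      smul_mem' := fun s m hm => by
        obtain ⟨r, rfl⟩ := hf s
        rw [h]
        exact p.smul_mem r hm }
  have hF : StrictMono F := by
    intro p q hpq
    have h1 : ∀ p q : Submodule R M, F p ≤ F q ↔ p ≤ q := fun p q => Iff.rfl
    rw [lt_iff_le_not_ge] at hpq ⊢
    simpa [h1] using hpq
  exact hF.wellFoundedLT

theorem isArtinian_of_finset_span {R M : Type*} [Ring R] [AddCommGroup M] [Module R M]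
    (s : Finset M) (N : Submodule R M) (hN : N ≤ Submodule.span R (s : Set M))
    (h : ∀ x ∈ s, IsArtinian R (Submodule.span R {x})) : IsArtinian R N := by
  have : IsArtinian R (⨆ x : s, Submodule.span R {(x : M)} : Submodule R M) := by
    have : ∀ x : s, IsArtinian R (Submodule.span R {(x : M)}) := fun x => h x x.2
    exact isArtinian_iSup
  refine isArtinian_of_le (t := (⨆ x : s, Submodule.span R {(x : M)} : Submodule R M)) ?_
  refine hN.trans (Submodule.span_le.2 fun x hx => ?_)
  exact Submodule.mem_iSup_of_mem (⟨x, hx⟩ : s) (Submodule.mem_span_singleton_self x)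

/-- The descending chain condition on principal right ideals, in terms of elements. -/
def DCCPrincipalRight (R : Type*) [Ring R] : Prop :=
  ∀ a P : ℕ → R, (∀ n, P (n + 1) = P n * a n) → ∃ m b, P m = P (m + 1) * b

theorem DCCPrincipalRight.of_surjective {R S : Type*} [Ring R] [Ring S] (f : R →+* S)
    (hf : Function.Surjective f) (hR : DCCPrincipalRight R) : DCCPrincipalRight S := by
  intro a P hP
  choose a' ha' using fun n => hf (a n)
  obtain ⟨p, hp⟩ := hf (P 0)
  let Q : ℕ → R := fun n => Nat.rec p (fun n x => x * a' n) n
  have hQ : ∀ n, f (Q n) = P n := by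
    intro n
    induction n with
    | zero => exact hp
    | succ n ih =>
      rw [hP, ← ih, ← ha']
      exact map_mul f _ _
  obtain ⟨m, b, hb⟩ := hR a' Q (fun n => rfl)
  exact ⟨m, f b, by rw [← hQ, ← hQ, hb, map_mul]⟩

theorem DCCPrincipalRight.exists_minimal {R : Type*} [Ring R] [Nontrivial R]
    (hR : DCCPrincipalRight R) :
    ∃ a : R, a ≠ 0 ∧ ∀ c, a * c ≠ 0 → ∃ d, a * c * d = a := by
  by_contra! H
  choose! c hc hd using H
  let P : ℕ → R := fun n => Nat.rec 1 (fun _ x => x * c x) n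
  have hP0 : ∀ n, P n ≠ 0 := by
    intro n
    induction n with
    | zero => exact one_ne_zero
    | succ n ih => exact hc _ ih
  obtain ⟨m, b, hb⟩ := hR (fun n => c (P n)) P (fun n => rfl)
  exact hd (P m) (hP0 m) b hb.symm

/-- A minimal nonzero principal right ideal `a S` forces the left ideal `S a` to be simple, by
primeness. The two-sided ideal `S a S` is then a finite sum of images of `S a`, hence artinian, and
the quotient by it is artinian by hypothesis. -/
theorem isArtinianRing_of_prime {S : Type*} [Ring S] [Nontrivial S] [IsNoetherianRing S]
    (hdcc : DCCPrincipalRight S) (hprime : ∀ a b : S, a ≠ 0 → b ≠ 0 → ∃ c, a * c * b ≠ 0)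
    (hquot : ∀ I : Ideal S, I.IsTwoSided → I ≠ ⊥ → IsArtinian S (S ⧸ I)) :
    IsArtinianRing S := by
  obtain ⟨a, ha, hmin⟩ := hdcc.exists_minimal
  -- By minimality of `a S`, left multiplication by `a * y` on it is injective as soon as it does
  -- not kill `a`.
  have hinj : ∀ y, a * y * a ≠ 0 → ∀ t, a * y * (a * t) = 0 → a * t = 0 := by
    intro y hy t ht
    by_contra h
    obtain ⟨d, hd⟩ := hmin t h
    apply hy
    have : a * y * a = a * y * (a * t) * d := by rw [mul_assoc (a * y), hd]
    rw [this, ht, zero_mul]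
  -- This is simplicity of `S a`. Primeness gives `c` with `a * c * s * a ≠ 0`, minimality gives `d`
  -- with `a * c * s * a * d = a`, and injectivity on `a S` turns this right inverse into a left
  -- one.
  have hsimple : ∀ s, s * a ≠ 0 → ∃ z, z * (s * a) = a := by
    intro s hs
    obtain ⟨c, hc⟩ := hprime a (s * a) ha hs
    have hy : a * (c * s) * a ≠ 0 := by simpa only [mul_assoc] using hc
    obtain ⟨d, hd⟩ := hmin (c * s * a) (by simpa only [mul_assoc] using hy)
    refine ⟨a * d * c, ?_⟩
    have h1 : a * (c * s) * (a * (d * c * s * a - 1)) = 0 := by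
      have : a * (c * s) * (a * (d * c * s * a - 1))
          = a * (c * s * a) * d * (c * s * a) - a * (c * s * a) := by noncomm_ring
      rw [this, hd]
      noncomm_ring
    have h2 := hinj _ hy _ h1
    have h3 : a * (d * c * s * a - 1) = a * d * c * (s * a) - a := by noncomm_ring
    rw [h3] at h2
    exact sub_eq_zero.1 h2
  have hsimp : ∀ t : S, IsArtinian S (Submodule.span S {a * t}) := by
    intro t
    have h0 : IsArtinian S (Submodule.span S {a}) := by
      have : IsSimpleModule S (Submodule.span S {a}) := by
        rw [isSimpleModule_iff_isAtom]
        refine ⟨by simpa using ha, fun N hN => ?_⟩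
        by_contra hne
        obtain ⟨x, hx, hx0⟩ := (Submodule.ne_bot_iff _).1 hne
        obtain ⟨s, rfl⟩ := Submodule.mem_span_singleton.1 (hN.le hx)
        obtain ⟨z, hz⟩ := hsimple s hx0
        refine hN.not_ge ((Submodule.span_singleton_le_iff_mem _ _).2 ?_)
        rw [← hz]
        exact N.smul_mem z hx
      infer_instance
    have h1 : Submodule.span S {a * t}
        = (Submodule.span S {a}).map (LinearMap.toSpanSingleton S S t) := by
      rw [Submodule.map_span]
      simp
    rw [h1]
    have : Function.Surjective ((LinearMap.toSpanSingleton S S t).submoduleMap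
      (Submodule.span S {a})) := LinearMap.submoduleMap_surjective _ _
    exact isArtinian_of_surjective _ _ this
  let I : Ideal S := Submodule.span S (Set.range fun t => a * t)
  have hI : I.IsTwoSided := by
    refine ⟨fun {x} b hx => ?_⟩
    induction hx using Submodule.span_induction with
    | mem x hx =>
      obtain ⟨t, rfl⟩ := hx
      exact Submodule.subset_span ⟨t * b, by simp [mul_assoc]⟩
    | zero => simp
    | add x y _ _ hx hy => rw [add_mul]; exact I.add_mem hx hy
    | smul c x _ hx => rw [smul_eq_mul, mul_assoc]; exact I.smul_mem c hx
  have hI0 : I ≠ ⊥ := by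
    intro h
    have : a ∈ I := Submodule.subset_span ⟨1, by simp⟩
    rw [h] at this
    exact ha (by simpa using this)
  have hIA : IsArtinian S I := by
    obtain ⟨s, hs, hs'⟩ := (Submodule.fg_span_iff_fg_span_finset_subset _).1
      (IsNoetherian.noetherian I)
    refine isArtinian_of_finset_span s I hs'.le fun x hx => ?_
    obtain ⟨t, rfl⟩ := hs hx
    exact hsimp t
  have := hquot I hI hI0
  exact (isArtinian_iff_submodule_quotient I).2 ⟨hIA, this⟩

/-- If `S` is not prime, say `a S b = 0`, then `J = S b S` is a finitely generated left module over
`S ⧸ I`, where `I` is the left annihilator of `J` and contains `a`. Both `S ⧸ I` and `S ⧸ J` are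
artinian, so `J` and `S` are. -/
theorem isArtinianRing_of_quotients {S : Type*} [Ring S] [IsNoetherianRing S]
    (hdcc : DCCPrincipalRight S)
    (hquot : ∀ I : Ideal S, I.IsTwoSided → I ≠ ⊥ → IsArtinian S (S ⧸ I)) :
    IsArtinianRing S := by
  rcases subsingleton_or_nontrivial S with hS | hS
  · infer_instance
  by_cases hprime : ∀ a b : S, a ≠ 0 → b ≠ 0 → ∃ c, a * c * b ≠ 0
  · exact isArtinianRing_of_prime hdcc hprime hquot
  push Not at hprime
  obtain ⟨a, b, ha, hb, hab⟩ := hprime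
  let J : Ideal S := Submodule.span S (Set.range fun t => b * t)
  have hJ : J.IsTwoSided := by
    refine ⟨fun {x} b hx => ?_⟩
    induction hx using Submodule.span_induction with
    | mem x hx =>
      obtain ⟨t, rfl⟩ := hx
      exact Submodule.subset_span ⟨t * b, by simp [mul_assoc]⟩
    | zero => simp
    | add x y _ _ hx hy => rw [add_mul]; exact J.add_mem hx hy
    | smul c x _ hx => rw [smul_eq_mul, mul_assoc]; exact J.smul_mem c hx
  have hJ0 : J ≠ ⊥ := by
    intro h
    have : b ∈ J := Submodule.subset_span ⟨1, by simp⟩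
    rw [h] at this
    exact hb (by simpa using this)
  let I : Ideal S := Module.annihilator S J
  have hmemI : ∀ x, x ∈ I ↔ ∀ y ∈ J, x * y = 0 := by
    intro x
    simp only [I, Module.mem_annihilator, Subtype.forall, Subtype.ext_iff]
    rfl
  have hI : I.IsTwoSided := inferInstance
  have hI0 : I ≠ ⊥ := by
    intro h
    have : a ∈ I := by
      rw [hmemI]
      intro y hy
      have h2 : ∀ c, a * (c * y) = 0 := by
        induction hy using Submodule.span_induction with
        | mem x hx =>
          obtain ⟨t, rfl⟩ := hx
          intro c
          calc a * (c * (b * t)) = a * c * b * t := by simp only [mul_assoc]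
            _ = 0 := by rw [hab, zero_mul]
        | zero => simp
        | add x y _ _ hx hy => intro c; rw [mul_add, mul_add, hx, hy, add_zero]
        | smul d x _ hx => intro c; rw [smul_eq_mul, ← mul_assoc c, hx]
      simpa using h2 1
    rw [h] at this
    exact ha (by simpa using this)
  have h1 := hquot I hI hI0
  have h2 := hquot J hJ hJ0
  refine (isArtinian_iff_submodule_quotient J).2 ⟨?_, h2⟩
  obtain ⟨s, hs⟩ := IsNoetherian.noetherian J
  refine isArtinian_of_finset_span s J hs.ge fun x hx => ?_
  have hxJ : x ∈ J := hs ▸ Submodule.subset_span hx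
  have hle : I ≤ LinearMap.ker (LinearMap.toSpanSingleton S S x) := by
    intro y hy
    simpa using (hmemI y).1 hy x hxJ
  have : Submodule.span S {x} = LinearMap.range (Submodule.liftQ I _ hle) := by
    rw [Submodule.range_liftQ, LinearMap.range_toSpanSingleton]
  rw [this]
  infer_instance

/-- A left noetherian ring with the descending chain condition on principal right ideals is left
artinian. -/
theorem isArtinianRing_of_dcc {R : Type*} [Ring R] [IsNoetherianRing R]
    (hdcc : DCCPrincipalRight R) : IsArtinianRing R := by
  have key : ∀ I : Ideal R, I.IsTwoSided → IsArtinian R (R ⧸ I) := by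
    intro I
    induction I using IsNoetherian.induction with
    | hgt I ih =>
    intro hI
    have hdccQ := hdcc.of_surjective (Ideal.Quotient.mk I) Ideal.Quotient.mk_surjective
    have : IsNoetherianRing (R ⧸ I) := isNoetherian_of_tower R inferInstance
    have hart : IsArtinianRing (R ⧸ I) := by
      refine isArtinianRing_of_quotients hdccQ fun L hL hL0 => ?_
      have hJ : (L.comap (Ideal.Quotient.mk I)).IsTwoSided := inferInstance
      have hlt : I < L.comap (Ideal.Quotient.mk I) := by
        refine lt_of_le_of_ne ?_ ?_
        · intro x hx
          rw [Ideal.mem_comap, Ideal.Quotient.eq_zero_iff_mem.2 hx]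
          exact L.zero_mem
        · intro heq
          apply hL0
          rw [eq_bot_iff]
          intro x hx
          obtain ⟨x, rfl⟩ := Ideal.Quotient.mk_surjective x
          have : x ∈ I := by rw [heq]; exact hx
          simpa using Ideal.Quotient.eq_zero_iff_mem.2 this
      have hA := ih _ hlt hJ
      let q : R →ₗ[R] ((R ⧸ I) ⧸ L) :=
        (L.mkQ.restrictScalars R).comp (Submodule.mkQ I)
      have hq : L.comap (Ideal.Quotient.mk I) ≤ LinearMap.ker q := by
        intro x hx
        exact (Submodule.Quotient.mk_eq_zero L).2 hx
      have hsurj : Function.Surjective (Submodule.liftQ _ q hq) := by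
        intro y
        obtain ⟨y, rfl⟩ := L.mkQ_surjective y
        obtain ⟨y, rfl⟩ := Submodule.mkQ_surjective I y
        exact ⟨Submodule.Quotient.mk y, rfl⟩
      have : IsArtinian R ((R ⧸ I) ⧸ L) := isArtinian_of_surjective _ _ hsurj
      exact isArtinian_of_tower R this
    exact isArtinian_of_surjective_ringHom (Ideal.Quotient.mk I) Ideal.Quotient.mk_surjective
      (fun r m => rfl)
  have := key ⊥ inferInstance
  exact isArtinian_of_linearEquiv (Submodule.quotEquivOfEqBot (⊥ : Ideal R) rfl)

end Chase

/-! ### Left pure-semisimple rings are left artinian -/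

section PureSemisimple

variable {S : Type u} [Ring S]

/-- On finitely many elements, the identity of a pure-projective module agrees with an endomorphism
that factors through a finitely presented module. -/
theorem IsPureProjective.exists_factor {M : Type u} [AddCommGroup M] [Module S M]
    (h : IsPureProjective S M) (s : Set M) (hs : s.Finite) :
    ∃ (P : Type u) (_ : AddCommGroup P) (_ : Module S P) (α : M →ₗ[S] P) (β : P →ₗ[S] M),
      Module.FinitePresentation S P ∧ ∀ x ∈ s, β (α x) = x := by
  classical
  obtain ⟨ι, F, _, _, K, _, _, hF, ⟨e⟩⟩ := h
  let a : M →ₗ[S] ⨁ i, F i := e.toLinearMap ∘ₗ LinearMap.inl S M K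
  let b : (⨁ i, F i) →ₗ[S] M := LinearMap.fst S M K ∘ₗ e.symm.toLinearMap
  have hba : ∀ x, b (a x) = x := fun x => by simp [a, b]
  -- Only the summands that meet the images of the finitely many given elements matter, and a finite
  -- product of finitely presented modules is finitely presented.
  let T : Finset ι := hs.toFinset.biUnion fun x => DFinsupp.support (a x)
  refine ⟨∀ i : T, F i, inferInstance, inferInstance,
    LinearMap.pi fun i => DirectSum.component S ι F i ∘ₗ a,
    b ∘ₗ ∑ i : T, DirectSum.lof S ι F i ∘ₗ LinearMap.proj i, ?_, ?_⟩
  · have := hF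
    infer_instance
  · intro x hx
    have hsup : ∀ i, a x i ≠ 0 → i ∈ T := fun i hi =>
      Finset.mem_biUnion.2 ⟨x, by simpa using hx, by simpa [DFinsupp.mem_support_iff] using hi⟩
    conv_rhs => rw [← hba x]
    simp only [LinearMap.comp_apply, LinearMap.sum_apply, LinearMap.proj_apply,
      LinearMap.pi_apply]
    congr 1
    have : ∀ i : ι, i ∉ T → DirectSum.lof S ι F i (DirectSum.component S ι F i (a x)) = 0 := by
      intro i hi
      have : a x i = 0 := by
        by_contra h
        exact hi (hsup i h)
      rw [← DirectSum.apply_eq_component, this, map_zero]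
    rw [Finset.sum_coe_sort T
      (fun i => DirectSum.lof S ι F i (DirectSum.component S ι F i (a x)))]
    ext j
    simp only [DirectSum.sum_apply]
    by_cases hj : j ∈ T
    · rw [Finset.sum_eq_single j]
      · exact DirectSum.lof_apply S j _
      · intro i _ hij
        exact DirectSum.of_eq_of_ne _ _ _ (Ne.symm hij)
      · exact fun h => absurd hj h
    · have h0 : a x j = 0 := by
        by_contra h
        exact hj (hsup j h)
      rw [h0]
      refine Finset.sum_eq_zero fun i hi => ?_
      exact DirectSum.of_eq_of_ne _ _ _ (fun h => hj (h ▸ hi))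

theorem IsPureProjective.finitePresentation {M : Type u} [AddCommGroup M] [Module S M]
    (h : IsPureProjective S M) [hM : Module.Finite S M] : Module.FinitePresentation S M := by
  obtain ⟨s, hs⟩ := hM.fg_top
  obtain ⟨P, _, _, α, β, hP, hβ⟩ := h.exists_factor (s : Set M) s.finite_toSet
  have hid : β ∘ₗ α = LinearMap.id := by
    refine LinearMap.ext_on hs fun x hx => hβ x hx
  have hid' : ∀ x, β (α x) = x := fun x => LinearMap.congr_fun hid x
  refine Module.finitePresentation_of_surjective β (fun x => ⟨α x, hid' x⟩) ?_
  -- Since `α ∘ₗ β` is idempotent, the kernel is the range of the complementary projection, hence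
  -- finitely generated.
  have : LinearMap.ker β = LinearMap.range (LinearMap.id - α ∘ₗ β) := by
    ext x
    constructor
    · intro hx
      exact ⟨x, by simp [LinearMap.mem_ker.1 hx]⟩
    · rintro ⟨y, rfl⟩
      simp [hid']
  rw [this, LinearMap.range_eq_map]
  exact (Module.Finite.fg_top).map _

theorem IsLeftPureSemisimple.isNoetherianRing (h : IsLeftPureSemisimple S) :
    IsNoetherianRing S := by
  refine ⟨fun I => ?_⟩
  have : Module.FinitePresentation S (S ⧸ I) := (h (S ⧸ I)).finitePresentation
  have := Module.FinitePresentation.fg_ker I.mkQ I.mkQ_surjective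
  rwa [Submodule.ker_mkQ] at this

/-- The maps `σ n` present `C` as a direct limit: each relation in the kernel of `q` is killed at
some stage. A lift to `B` defined on the generators of `P` respects its finitely many relations once
it is pushed to a late enough stage. -/
theorem Module.FinitePresentation.exists_lift {P B C : Type*} [AddCommGroup P] [Module S P]
    [AddCommGroup B] [Module S B] [AddCommGroup C] [Module S C] [Module.FinitePresentation S P]
    (q : B →ₗ[S] C) (hq : Function.Surjective q) (σ : ℕ → B →ₗ[S] B)
    (hσ : ∀ n x, q (σ n x) = q x) (hker : ∀ x, q x = 0 → ∃ n, ∀ m, n ≤ m → σ m x = 0)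
    (f : P →ₗ[S] C) : ∃ g : P →ₗ[S] B, q ∘ₗ g = f := by
  obtain ⟨n, p, hp⟩ := Module.Finite.exists_fin' S P
  have hfg := Module.FinitePresentation.fg_ker p hp
  obtain ⟨H, hH⟩ := Module.projective_lifting_property q (f ∘ₗ p) hq
  obtain ⟨s, hs⟩ := hfg
  have hs0 : ∀ z ∈ s, q (H z) = 0 := by
    intro z hz
    have : z ∈ LinearMap.ker p := hs ▸ Submodule.subset_span hz
    have h2 := LinearMap.congr_fun hH z
    simp only [LinearMap.comp_apply] at h2
    rw [h2, LinearMap.mem_ker.1 this, map_zero]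
  choose! N hN using hker
  let m := s.sup fun z => N (H z)
  have hle : LinearMap.ker p ≤ LinearMap.ker (σ m ∘ₗ H) := by
    rw [← hs, Submodule.span_le]
    intro z hz
    exact hN _ (hs0 z hz) m (Finset.le_sup (f := fun z => N (H z)) hz)
  refine ⟨(LinearMap.ker p).liftQ (σ m ∘ₗ H) hle ∘ₗ
    (p.quotKerEquivOfSurjective hp).symm.toLinearMap, ?_⟩
  ext x
  obtain ⟨y, rfl⟩ := hp x
  have : (p.quotKerEquivOfSurjective hp).symm (p y) = Submodule.Quotient.mk y := by
    rw [LinearEquiv.symm_apply_eq]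
    rfl
  simp only [LinearMap.comp_apply, LinearEquiv.coe_coe, this, Submodule.liftQ_apply]
  rw [hσ]
  exact LinearMap.congr_fun hH y

/-! ### Telescopes of right multiplications -/

section Telescope

variable (a : ℕ → S)

/-- The map from the first terms of `R → R → R → ⋯` to the `m`-th term. -/
noncomputable def toStage : ℕ → (ℕ →₀ S) →ₗ[S] S
  | 0 => Finsupp.lapply 0
  | m + 1 => LinearMap.toSpanSingleton S S (a m) ∘ₗ toStage m + Finsupp.lapply (m + 1)

theorem toStage_succ (m : ℕ) (x : ℕ →₀ S) :
    toStage a (m + 1) x = toStage a m x * a m + x (m + 1) := by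
  simp [toStage]

theorem toStage_single_of_lt {i m : ℕ} (h : m < i) (r : S) :
    toStage a m (Finsupp.single i r) = 0 := by
  induction m with
  | zero => simp [toStage, h.ne']
  | succ m ih => rw [toStage_succ, ih (by omega)]; simp [h.ne']

theorem toStage_single_self (m : ℕ) : toStage a m (Finsupp.single m 1) = 1 := by
  cases m with
  | zero => simp [toStage]
  | succ m => rw [toStage_succ, toStage_single_of_lt a (Nat.lt_succ_self m)]; simp

/-- The relations that define the colimit of `R → R → R → ⋯`, with maps the right
multiplications by the terms of the sequence `a`. -/
noncomputable def telescopeRel (n : ℕ) : ℕ →₀ S :=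
  Finsupp.single n 1 - Finsupp.single (n + 1) (a n)

theorem toStage_telescopeRel {n m : ℕ} (h : n < m) : toStage a m (telescopeRel a n) = 0 := by
  induction m with
  | zero => omega
  | succ m ih =>
    rw [toStage_succ]
    rcases Nat.lt_succ_iff_lt_or_eq.1 h with h' | rfl
    · rw [ih h']
      simp [telescopeRel, show n ≠ m + 1 by omega, h'.ne]
    · rw [telescopeRel, map_sub, toStage_single_self, toStage_single_of_lt a (Nat.lt_succ_self n)]
      simp

/-- The part of a finitely supported sequence in positions at least `m`, with the earlier terms
moved to position `m`. -/
noncomputable def moveToStage (m : ℕ) : (ℕ →₀ S) →ₗ[S] (ℕ →₀ S) :=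
  Finsupp.lsingle m ∘ₗ toStage a m +
    (Submodule.subtype _ ∘ₗ Finsupp.restrictDom S S {i : ℕ | m < i})

theorem moveToStage_apply (m : ℕ) (x : ℕ →₀ S) : moveToStage a m x =
    Finsupp.single m (toStage a m x) + x.filter (· ∈ {i : ℕ | m < i}) := by
  simp only [moveToStage, LinearMap.add_apply, LinearMap.comp_apply, Finsupp.lsingle_apply,
    Submodule.subtype_apply]
  congr 1

theorem moveToStage_telescopeRel {n m : ℕ} (h : n < m) :
    moveToStage a m (telescopeRel a n) = 0 := by
  rw [moveToStage_apply, toStage_telescopeRel a h, Finsupp.single_zero, zero_add]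
  ext i
  simp only [telescopeRel, Finsupp.filter_apply, Set.mem_ofPred_eq]
  split_ifs with hi
  · simp [show n ≠ i by omega, show n + 1 ≠ i by omega]
  · rfl

theorem moveToStage_sub_mem (m : ℕ) (x : ℕ →₀ S) :
    moveToStage a m x - x ∈ Submodule.span S (Set.range (telescopeRel a)) := by
  induction m with
  | zero =>
    have : moveToStage a 0 x = x := by
      rw [moveToStage_apply]
      ext i
      rcases Nat.eq_zero_or_pos i with rfl | hi
      · simp [toStage]
      · simp [hi, hi.ne]
    rw [this, sub_self]
    exact Submodule.zero_mem _
  | succ m ih =>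
    have : moveToStage a (m + 1) x - x = (moveToStage a m x - x)
        - toStage a m x • telescopeRel a m := by
      have h2 : (x.filter (· ∈ {i : ℕ | m < i})) = Finsupp.single (m + 1) (x (m + 1)) +
          x.filter (· ∈ {i : ℕ | m + 1 < i}) := by
        ext i
        simp only [Finsupp.filter_apply, Set.mem_ofPred_eq, Finsupp.add_apply,
          Finsupp.single_apply]
        rcases lt_trichotomy i (m + 1) with h | rfl | h
        · simp [show ¬ m < i by omega, show ¬ m + 1 < i by omega, show ¬ m + 1 = i by omega]
        · simp
        · simp [show m < i by omega, h, h.ne]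
      rw [moveToStage_apply, moveToStage_apply, h2, toStage_succ, telescopeRel, smul_sub,
        Finsupp.smul_single, Finsupp.smul_single, smul_eq_mul, smul_eq_mul, mul_one,
        Finsupp.single_add]
      abel
    rw [this]
    exact Submodule.sub_mem _ ih (Submodule.smul_mem _ _ (Submodule.subset_span ⟨m, rfl⟩))

end Telescope

/-- As in Bass's argument, the telescope of the right multiplications by `a n` is pure-projective,
so a map from it to the free module `ℕ →₀ S` can be chosen that lifts the image of the zeroth basis
vector. Comparing that lift with the basis vector at a late stage bounds the chain. -/
theorem IsLeftPureSemisimple.dccPrincipalRight (h : IsLeftPureSemisimple S) :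
    DCCPrincipalRight S := by
  intro a P hP
  let K := Submodule.span S (Set.range (telescopeRel a))
  let q := K.mkQ
  have hσ : ∀ n x, q (moveToStage a n x) = q x := fun n x =>
    (Submodule.Quotient.eq K).2 (moveToStage_sub_mem a n x)
  have hker : ∀ x, q x = 0 → ∃ n, ∀ m, n ≤ m → moveToStage a m x = 0 := by
    intro x hx
    replace hx : x ∈ K := (Submodule.Quotient.mk_eq_zero K).1 hx
    induction hx using Submodule.span_induction with
    | mem x hx =>
      obtain ⟨n, rfl⟩ := hx
      exact ⟨n + 1, fun m hm => moveToStage_telescopeRel a hm⟩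
    | zero => exact ⟨0, fun m _ => map_zero _⟩
    | add x y hx hy ihx ihy =>
      obtain ⟨n, hn⟩ := ihx
      obtain ⟨n', hn'⟩ := ihy
      refine ⟨max n n', fun m hm => ?_⟩
      rw [map_add, hn m (le_trans (le_max_left _ _) hm), hn' m (le_trans (le_max_right _ _) hm),
        add_zero]
    | smul c x hx ihx =>
      obtain ⟨n, hn⟩ := ihx
      exact ⟨n, fun m hm => by rw [map_smul, hn m hm, smul_zero]⟩
  obtain ⟨F, _, _, α, β, hF, hβ⟩ := (h ((ℕ →₀ S) ⧸ K)).exists_factor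
    {q (Finsupp.single 0 1)} (Set.finite_singleton _)
  obtain ⟨g, hg⟩ := Module.FinitePresentation.exists_lift q K.mkQ_surjective (moveToStage a) hσ
    hker β
  let s : ((ℕ →₀ S) ⧸ K) →ₗ[S] (ℕ →₀ S) := g ∘ₗ α
  let y : ℕ → (ℕ →₀ S) := fun n => s (q (Finsupp.single n 1))
  have hq0 : q (y 0) = q (Finsupp.single 0 1) := by
    have := LinearMap.congr_fun hg (α (q (Finsupp.single 0 1)))
    exact this.trans (hβ _ rfl)
  have hstep : ∀ n, y n = a n • y (n + 1) := by
    intro n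
    have : q (Finsupp.single n 1) = a n • q (Finsupp.single (n + 1) 1) := by
      rw [← map_smul, Finsupp.smul_single, smul_eq_mul, mul_one]
      exact (Submodule.Quotient.eq K).2 (Submodule.subset_span ⟨n, rfl⟩)
    simp only [y]
    rw [this, map_smul]
  -- This is the product `a 0 * ⋯ * a (m - 1)`, so it suffices to stabilize the chain that starts
  -- from `1`.
  let p : ℕ → S := fun m => toStage a m (Finsupp.single 0 1)
  have hp : ∀ m, p (m + 1) = p m * a m := fun m => by
    simp only [p]
    rw [toStage_succ]
    simp
  have hPp : ∀ m, P m = P 0 * p m := by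
    intro m
    induction m with
    | zero => simp [p, toStage_single_self]
    | succ m ih => rw [hP, ih, hp, mul_assoc]
  have hy : ∀ m, y 0 = p m • y m := by
    intro m
    induction m with
    | zero => simp [p, toStage_single_self]
    | succ m ih => rw [ih, hp, mul_smul, ← hstep]
  obtain ⟨m, hm⟩ := hker (y 0 - Finsupp.single 0 1) (by rw [map_sub, hq0, sub_self])
  have h1 : ∀ x, moveToStage a m x = 0 → toStage a m x = 0 := by
    intro x hx
    have := DFunLike.congr_fun hx m
    rw [moveToStage_apply] at this
    simpa using this
  have h2 := h1 _ (hm m le_rfl)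
  -- At stage `m` the lift `y 0` and the basis vector agree, the latter giving `p m`; but `y 0` is
  -- also a left multiple by `p (m + 1)`, so `p m` lies in `p (m + 1) S`.
  rw [map_sub, sub_eq_zero, hy (m + 1), map_smul, smul_eq_mul] at h2
  refine ⟨m, toStage a m (y (m + 1)), ?_⟩
  rw [hPp m, hPp (m + 1), mul_assoc, h2]

/-- A left pure-semisimple ring is left artinian. -/
theorem IsLeftPureSemisimple.isArtinianRing (h : IsLeftPureSemisimple S) : IsArtinianRing S :=
  have := h.isNoetherianRing
  isArtinianRing_of_dcc h.dccPrincipalRight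

end PureSemisimple

/-! ### Gradings of additive groups -/

section Gradings

/-- A `ℤ`-grading of an additive group, given by the map that sends an element to the family of
its homogeneous components. -/
structure ZGrading (M : Type*) [AddCommGroup M] where
  /-- The homogeneous components of an element. -/
  dec : M →+ (ℤ →₀ M)
  dec_dec : ∀ x i, dec (dec x i) = Finsupp.single i (dec x i)
  sum_dec : ∀ x, ((dec x).sum fun _ y => y) = x

namespace ZGrading

variable {M L : Type*} [AddCommGroup M] [AddCommGroup L]

/-- `x` is homogeneous of degree `i`. -/
def IsHom (g : ZGrading M) (i : ℤ) (x : M) : Prop := g.dec x = Finsupp.single i x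

variable (g : ZGrading M) (gL : ZGrading L)

theorem isHom_dec (x : M) (i : ℤ) : g.IsHom i (g.dec x i) := g.dec_dec x i

variable {g} in
theorem IsHom.dec_self {i : ℤ} {x : M} (h : g.IsHom i x) : g.dec x i = x := by
  rw [h, Finsupp.single_eq_same]

variable {g} in
theorem IsHom.dec_of_ne {i j : ℤ} {x : M} (h : g.IsHom i x) (hij : i ≠ j) : g.dec x j = 0 := by
  rw [h, Finsupp.single_eq_of_ne hij.symm]

theorem isHom_zero (i : ℤ) : g.IsHom i 0 := by simp [IsHom]

variable {g} in
theorem IsHom.add {i : ℤ} {x y : M} (hx : g.IsHom i x) (hy : g.IsHom i y) :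
    g.IsHom i (x + y) := by
  rw [IsHom, map_add, hx, hy, Finsupp.single_add]

variable {g} in
theorem IsHom.neg {i : ℤ} {x : M} (hx : g.IsHom i x) : g.IsHom i (-x) := by
  rw [IsHom, map_neg, hx, Finsupp.single_neg]

theorem induction {p : M → Prop} (hom : ∀ i x, g.IsHom i x → p x)
    (add : ∀ x y, p x → p y → p (x + y)) (x : M) : p x := by
  rw [← g.sum_dec x]
  exact Finset.sum_induction _ p add (hom 0 0 (g.isHom_zero 0)) fun i _ => hom i _ (g.isHom_dec x i)

theorem addHom_ext {X : Type*} [AddZeroClass X] {f f' : M →+ X}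
    (h : ∀ i x, g.IsHom i x → f x = f' x) : f = f' := by
  ext x
  induction x using g.induction with
  | hom i x hx => exact h i x hx
  | add x y hx hy => rw [map_add, map_add, hx, hy]

theorem eq_zero_of_dec {x : M} (h : ∀ i, g.dec x i = 0) : x = 0 := by
  rw [← g.sum_dec x]
  exact Finset.sum_eq_zero fun i _ => h i

/-- An additive map is homogeneous of degree `k`. -/
def IsHomMap (k : ℤ) (f : M →+ L) : Prop := ∀ i x, g.IsHom i x → gL.IsHom (i + k) (f x)

variable {g gL} in
theorem IsHomMap.dec_apply {k : ℤ} {f : M →+ L} (h : g.IsHomMap gL k f) (x : M) (i : ℤ) :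
    gL.dec (f x) (i + k) = f (g.dec x i) := by
  induction x using g.induction with
  | hom j x hx =>
    rw [h j x hx, hx]
    by_cases hij : j = i
    · subst hij; simp
    · rw [Finsupp.single_eq_of_ne (by omega), Finsupp.single_eq_of_ne (by omega), map_zero]
  | add x y hx hy => simp only [map_add, Finsupp.add_apply, hx, hy]

variable {g gL} in
theorem IsHomMap.dec_apply' {k : ℤ} {f : M →+ L} (h : g.IsHomMap gL k f) (x : M) (i : ℤ) :
    gL.dec (f x) i = f (g.dec x (i - k)) := by
  rw [← h.dec_apply, sub_add_cancel]

/-- The homogeneous part of degree `k` of an additive map. -/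
noncomputable def degPartAdd (k : ℤ) (f : M →+ L) : M →+ L :=
  (Finsupp.liftAddHom fun i => (Finsupp.applyAddHom (i + k)).comp (gL.dec.comp f)).comp g.dec

theorem degPartAdd_of_isHom {k i : ℤ} (f : M →+ L) {x : M} (hx : g.IsHom i x) :
    g.degPartAdd gL k f x = gL.dec (f x) (i + k) := by
  simp only [degPartAdd, AddMonoidHom.comp_apply]
  rw [hx]
  simp

theorem isHomMap_degPartAdd (k : ℤ) (f : M →+ L) : g.IsHomMap gL k (g.degPartAdd gL k f) := by
  intro i x hx
  rw [g.degPartAdd_of_isHom gL f hx]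
  exact gL.isHom_dec _ _

/-- The grading of the target of a surjective map with homogeneous kernel. -/
noncomputable def ofSurjective (π : M →+ L) (hπ : Function.Surjective π)
    (hker : ∀ x, π x = 0 → ∀ i, π (g.dec x i) = 0) : ZGrading L := by
  have key : ∀ x y, π x = π y → Finsupp.mapRange.addMonoidHom π (g.dec x) =
      Finsupp.mapRange.addMonoidHom π (g.dec y) := by
    intro x y h
    ext i
    have := hker (x - y) (by rw [map_sub, h, sub_self]) i
    simpa [sub_eq_zero] using this
  have hs : ∀ x, Finsupp.mapRange.addMonoidHom π (g.dec (Function.surjInv hπ (π x))) =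
      Finsupp.mapRange.addMonoidHom π (g.dec x) := fun x =>
    key _ _ (Function.surjInv_eq hπ _)
  exact
  { dec :=
      { toFun := fun y => Finsupp.mapRange.addMonoidHom π (g.dec (Function.surjInv hπ y))
        map_zero' := by
          rw [← map_zero π, hs]
          simp
        map_add' := fun x y => by
          obtain ⟨x, rfl⟩ := hπ x
          obtain ⟨y, rfl⟩ := hπ y
          rw [← map_add π, hs, hs, hs, map_add, map_add] }
    dec_dec := fun x i => by
      obtain ⟨x, rfl⟩ := hπ x
      simp only [AddMonoidHom.coe_mk, ZeroHom.coe_mk]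
      rw [hs]
      simp only [Finsupp.mapRange.addMonoidHom_apply, Finsupp.mapRange_apply]
      have := hs (g.dec x i)
      rw [Finsupp.mapRange.addMonoidHom_apply] at this
      rw [this, g.dec_dec]
      simp
    sum_dec := fun x => by
      obtain ⟨x, rfl⟩ := hπ x
      simp only [AddMonoidHom.coe_mk, ZeroHom.coe_mk]
      rw [hs, Finsupp.mapRange.addMonoidHom_apply, Finsupp.sum_mapRange_index (fun _ => rfl)]
      conv_rhs => rw [← g.sum_dec x, map_finsuppSum] }

section
variable (π : M →+ L) (hπ : Function.Surjective π) (hker : ∀ x, π x = 0 → ∀ i, π (g.dec x i) = 0)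

theorem ofSurjective_dec (x : M) (i : ℤ) : (g.ofSurjective π hπ hker).dec (π x) i =
    π (g.dec x i) := by
  have := hker (Function.surjInv hπ (π x) - x) (by
    rw [map_sub, Function.surjInv_eq hπ, sub_self]) i
  rw [map_sub, Finsupp.sub_apply, map_sub, sub_eq_zero] at this
  exact this

theorem ofSurjective_isHomMap : g.IsHomMap (g.ofSurjective π hπ hker) 0 π := by
  intro i x hx
  rw [add_zero]
  ext j
  rw [ofSurjective_dec, hx]
  by_cases h : j = i
  · subst h; simp
  · rw [Finsupp.single_eq_of_ne h, Finsupp.single_eq_of_ne h, map_zero]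

end

/-- The grading of the source of an injective map with homogeneous range. -/
noncomputable def ofInjective (ι : L →+ M) (hι : Function.Injective ι)
    (hr : ∀ x i, ∃ y, ι y = g.dec (ι x) i) : ZGrading L := by
  choose c hc using hr
  have hc0 : ∀ x i, g.dec (ι x) i = 0 → c x i = 0 := fun x i h => by
    apply hι
    rw [hc, h, map_zero]
  exact
  { dec :=
      { toFun := fun x => Finsupp.onFinset (g.dec (ι x)).support (c x) fun i hi => by
          rw [Finsupp.mem_support_iff]
          exact fun h => hi (hc0 x i h)
        map_zero' := by
          ext i
          exact hc0 _ _ (by simp)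
        map_add' := fun x y => by
          ext i
          apply hι
          simp [hc] }
    dec_dec := fun x i => by
      ext j
      apply hι
      simp only [AddMonoidHom.coe_mk, ZeroHom.coe_mk, Finsupp.onFinset_apply, hc, g.dec_dec]
      by_cases h : j = i
      · subst h; simp [hc]
      · simp [Finsupp.single_eq_of_ne h]
    sum_dec := fun x => by
      apply hι
      simp only [AddMonoidHom.coe_mk, ZeroHom.coe_mk]
      rw [Finsupp.onFinset_sum _ (fun _ => rfl), map_sum]
      simp only [hc]
      exact g.sum_dec (ι x) }

section
variable (ι : L →+ M) (hι : Function.Injective ι) (hr : ∀ x i, ∃ y, ι y = g.dec (ι x) i)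

theorem ofInjective_dec (x : L) (i : ℤ) :
    ι ((g.ofInjective ι hι hr).dec x i) = g.dec (ι x) i :=
  Classical.choose_spec (hr x i)

theorem ofInjective_isHom_iff (x : L) (i : ℤ) :
    (g.ofInjective ι hι hr).IsHom i x ↔ g.IsHom i (ι x) := by
  constructor
  · intro h
    have := g.isHom_dec (ι x) i
    rwa [← g.ofInjective_dec ι hι hr, h.dec_self] at this
  · intro h
    ext j
    apply hι
    rw [ofInjective_dec, h]
    by_cases h : j = i
    · subst h; simp
    · rw [Finsupp.single_eq_of_ne h, Finsupp.single_eq_of_ne h, map_zero]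

end

/-- The product grading. -/
noncomputable def prod : ZGrading (M × L) where
  dec := ((Finsupp.mapRange.addMonoidHom (AddMonoidHom.inl M L)).comp g.dec).coprod
    ((Finsupp.mapRange.addMonoidHom (AddMonoidHom.inr M L)).comp gL.dec)
  dec_dec x i := by
    obtain ⟨x, y⟩ := x
    have hx := g.dec_dec x i
    have hy := gL.dec_dec y i
    simp [hx, hy, ← Finsupp.single_add]
  sum_dec x := by
    obtain ⟨x, y⟩ := x
    simp only [AddMonoidHom.coprod_apply, AddMonoidHom.comp_apply,
      Finsupp.mapRange.addMonoidHom_apply]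
    rw [Finsupp.sum_add_index' (fun _ => rfl) (fun _ _ _ => rfl),
      Finsupp.sum_mapRange_index (fun _ => rfl), Finsupp.sum_mapRange_index (fun _ => rfl)]
    conv_rhs => rw [← g.sum_dec x, ← gL.sum_dec y]
    have h1 := map_finsuppSum (AddMonoidHom.inl M L) (g.dec x) (fun _ y => y)
    have h2 := map_finsuppSum (AddMonoidHom.inr M L) (gL.dec y) (fun _ y => y)
    rw [← h1, ← h2]
    simp

theorem prod_dec (x : M × L) (i : ℤ) :
    (g.prod gL).dec x i = (g.dec x.1 i, gL.dec x.2 i) := by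
  simp [prod]

theorem prod_isHom_iff (x : M × L) (i : ℤ) :
    (g.prod gL).IsHom i x ↔ g.IsHom i x.1 ∧ gL.IsHom i x.2 := by
  constructor
  · intro h
    have h1 := h.dec_self
    rw [prod_dec] at h1
    exact ⟨by rw [← h1]; exact g.isHom_dec _ _, by rw [← h1]; exact gL.isHom_dec _ _⟩
  · rintro ⟨h1, h2⟩
    ext1 j
    rw [prod_dec, h1, h2]
    by_cases h : j = i
    · subst h; simp
    · simp [Finsupp.single_eq_of_ne h]

/-- The grading with all degrees raised by `d`. -/
noncomputable def shift (d : ℤ) : ZGrading M where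
  dec := (Finsupp.mapDomain.addMonoidHom (· + d)).comp g.dec
  dec_dec x i := by
    have h : ∀ y : ℤ →₀ M, Finsupp.mapDomain (· + d) y i = y (i - d) := fun y => by
      conv_lhs => rw [← sub_add_cancel i d]
      exact Finsupp.mapDomain_apply (add_left_injective d) _ _
    simp only [AddMonoidHom.comp_apply, Finsupp.mapDomain.addMonoidHom_apply, h]
    rw [g.dec_dec, Finsupp.mapDomain_single, sub_add_cancel]
  sum_dec x := by
    simp only [AddMonoidHom.comp_apply, Finsupp.mapDomain.addMonoidHom_apply]
    rw [Finsupp.sum_mapDomain_index (fun _ => rfl) (fun _ _ _ => rfl)]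
    exact g.sum_dec x

theorem shift_isHom_iff (d i : ℤ) (x : M) : (g.shift d).IsHom i x ↔ g.IsHom (i - d) x := by
  simp only [IsHom, shift, AddMonoidHom.comp_apply, Finsupp.mapDomain.addMonoidHom_apply]
  have : Finsupp.single i x = Finsupp.mapDomain (· + d) (Finsupp.single (i - d) x) := by
    rw [Finsupp.mapDomain_single, sub_add_cancel]
  rw [this]
  exact (Finsupp.mapDomain_injective (add_left_injective d)).eq_iff

/-- The homogeneous elements of degree `i`. -/
def component (i : ℤ) : AddSubgroup M where
  carrier := {x | g.IsHom i x}
  zero_mem' := g.isHom_zero i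
  add_mem' := IsHom.add
  neg_mem' := IsHom.neg

theorem isInternal_component : DirectSum.IsInternal g.component := by
  classical
  have hcoe : ∀ (y : ⨁ i, g.component i) (i : ℤ),
      g.dec (DirectSum.coeAddMonoidHom g.component y) i = y i := by
    intro y i
    induction y using DirectSum.induction_on with
    | zero => simp
    | of j y =>
      rw [DirectSum.coeAddMonoidHom_of]
      have hy : g.IsHom j (y : M) := y.2
      rw [hy]
      by_cases h : j = i
      · subst h; simp
      · rw [Finsupp.single_eq_of_ne (Ne.symm h), DirectSum.of_eq_of_ne _ _ _ (Ne.symm h)]; rfl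
    | add x y hx hy => simp [hx, hy]
  refine ⟨fun x y h => ?_, fun x => ?_⟩
  · refine DFinsupp.ext fun i => Subtype.ext ?_
    rw [← hcoe, ← hcoe, h]
  · refine ⟨∑ i ∈ (g.dec x).support,
      DirectSum.of (fun i => g.component i) i ⟨g.dec x i, g.isHom_dec x i⟩, ?_⟩
    rw [map_sum]
    simp only [DirectSum.coeAddMonoidHom_of]
    exact g.sum_dec x

/-- The grading with given homogeneous components. -/
noncomputable def ofDecomposition (𝒜 : ℤ → AddSubgroup M) [DirectSum.Decomposition 𝒜] :
    ZGrading M where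
  dec := (DirectSum.toAddMonoid fun i =>
    (Finsupp.singleAddHom i).comp (𝒜 i).subtype).comp
      (DirectSum.decomposeAddEquiv 𝒜).toAddMonoidHom
  dec_dec x i := by
    induction x using DirectSum.Decomposition.inductionOn 𝒜 with
    | zero => simp
    | @homogeneous j x =>
      by_cases h : j = i
      · subst h; simp
      · simp [Finsupp.single_eq_of_ne (Ne.symm h)]
    | add x y hx hy => rw [map_add, Finsupp.add_apply, map_add, hx, hy, Finsupp.single_add]
  sum_dec x := by
    induction x using DirectSum.Decomposition.inductionOn 𝒜 with
    | zero => simp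
    | @homogeneous j x => simp
    | add x y hx hy =>
      rw [map_add, Finsupp.sum_add_index' (fun _ => rfl) (fun _ _ _ => rfl), hx, hy]

theorem ofDecomposition_isHom_iff (𝒜 : ℤ → AddSubgroup M) [DirectSum.Decomposition 𝒜] (i : ℤ)
    (x : M) : (ofDecomposition 𝒜).IsHom i x ↔ x ∈ 𝒜 i := by
  constructor
  · intro h
    rw [← h.dec_self]
    generalize hx : x = y
    clear h hx x
    induction y using DirectSum.Decomposition.inductionOn 𝒜 with
    | zero => simp
    | @homogeneous j x =>
      by_cases h : j = i
      · subst h; simp [ofDecomposition]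
      · simp [ofDecomposition, Finsupp.single_eq_of_ne (Ne.symm h)]
    | add x y hx hy => rw [map_add, Finsupp.add_apply]; exact add_mem hx hy
  · intro h
    lift x to 𝒜 i using h
    simp [IsHom, ofDecomposition]

end ZGrading

end Gradings

/-! ### Graded modules and the Laurent module -/

section GradedModules

/-- A `ℤ`-grading of a ring. -/
structure RingZGrading (S : Type*) [Ring S] extends ZGrading S where
  one_isHom : toZGrading.IsHom 0 1
  mul_isHom : ∀ {i j : ℤ} {x y : S}, toZGrading.IsHom i x → toZGrading.IsHom j y →
    toZGrading.IsHom (i + j) (x * y)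

variable {S : Type*} [Ring S] (g : RingZGrading S)
variable {M L N : Type*} [AddCommGroup M] [Module S M] [AddCommGroup L] [Module S L]
  [AddCommGroup N]

namespace RingZGrading

/-- A grading of a module that is compatible with the grading of the ring. -/
def IsModGrading (gM : ZGrading M) : Prop :=
  ∀ ⦃i j : ℤ⦄ ⦃r : S⦄ ⦃m : M⦄, g.IsHom i r → gM.IsHom j m → gM.IsHom (i + j) (r • m)

theorem isModGrading_self : g.IsModGrading g.toZGrading := fun _ _ _ _ => g.mul_isHom

variable {g}

theorem IsModGrading.dec_smul {gM : ZGrading M} (h : g.IsModGrading gM) {j : ℤ} {r : S}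
    (hr : g.IsHom j r) (x : M) (i : ℤ) : gM.dec (r • x) (j + i) = r • gM.dec x i := by
  have : gM.IsHomMap gM j (DistribSMul.toAddMonoidHom M r) := fun i x hx => by
    rw [add_comm]
    exact h hr hx
  have := this.dec_apply x i
  rwa [add_comm] at this

theorem IsModGrading.dec_smul' {gM : ZGrading M} (h : g.IsModGrading gM) {j : ℤ} {r : S}
    (hr : g.IsHom j r) (x : M) (i : ℤ) : gM.dec (r • x) i = r • gM.dec x (i - j) := by
  rw [← h.dec_smul hr, add_sub_cancel]

theorem IsModGrading.ofSurjective {gM : ZGrading M} (h : g.IsModGrading gM) (π : M →ₗ[S] L)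
    (hπ : Function.Surjective π.toAddMonoidHom)
    (hker : ∀ x, π.toAddMonoidHom x = 0 → ∀ i, π.toAddMonoidHom (gM.dec x i) = 0) :
    g.IsModGrading (gM.ofSurjective π.toAddMonoidHom hπ hker) := by
  intro i j r m hr hm
  obtain ⟨x, rfl⟩ := hπ m
  have h1 := gM.ofSurjective_isHomMap π.toAddMonoidHom hπ hker _ _ (h hr (gM.isHom_dec x j))
  rw [add_zero] at h1
  have h2 : π.toAddMonoidHom (gM.dec x j) = π.toAddMonoidHom x := by
    rw [← gM.ofSurjective_dec π.toAddMonoidHom hπ hker, hm.dec_self]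
  have h3 : π.toAddMonoidHom (r • gM.dec x j) = r • π.toAddMonoidHom x := by
    rw [← h2]
    exact map_smul π _ _
  rwa [h3] at h1

theorem IsModGrading.ofInjective {gM : ZGrading M} (h : g.IsModGrading gM) (ι : L →ₗ[S] M)
    (hι : Function.Injective ι.toAddMonoidHom)
    (hr : ∀ x i, ∃ y, ι.toAddMonoidHom y = gM.dec (ι.toAddMonoidHom x) i) :
    g.IsModGrading (gM.ofInjective ι.toAddMonoidHom hι hr) := by
  intro i j r m hr' hm
  rw [ZGrading.ofInjective_isHom_iff] at hm ⊢
  have := h hr' hm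
  rwa [show r • ι.toAddMonoidHom m = ι.toAddMonoidHom (r • m) from (map_smul ι r m).symm] at this

theorem IsModGrading.prod {gM : ZGrading M} (h : g.IsModGrading gM) {gL : ZGrading L}
    (hL : g.IsModGrading gL) : g.IsModGrading (gM.prod gL) := by
  intro i j r m hr hm
  rw [ZGrading.prod_isHom_iff] at hm ⊢
  exact ⟨h hr hm.1, hL hr hm.2⟩

theorem IsModGrading.shift {gM : ZGrading M} (h : g.IsModGrading gM) (d : ℤ) :
    g.IsModGrading (gM.shift d) := by
  intro i j r m hr hm
  rw [ZGrading.shift_isHom_iff] at hm ⊢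
  rw [add_sub_assoc]
  exact h hr hm

variable (g) in
/-- An additive map that commutes with homogeneous scalars is linear. -/
def linearMapOfHom (f : M →+ L) (h : ∀ i r, g.IsHom i r → ∀ x, f (r • x) = r • f x) :
    M →ₗ[S] L :=
  { f with
    map_smul' := fun r x => by
      induction r using g.toZGrading.induction with
      | hom i r hr => exact h i r hr x
      | add r s hr hs =>
        simp only [RingHom.id_apply, ZeroHom.toFun_eq_coe, AddMonoidHom.toZeroHom_coe] at hr hs ⊢
        rw [add_smul, map_add, hr, hs, add_smul] }

@[simp]
theorem linearMapOfHom_apply (f : M →+ L) (h : ∀ i r, g.IsHom i r → ∀ x, f (r • x) = r • f x)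
    (x : M) : g.linearMapOfHom f h x = f x := rfl

/-- The homogeneous part of degree `k` of a linear map. -/
noncomputable def degPart {gM : ZGrading M} {gL : ZGrading L} (hM : g.IsModGrading gM)
    (hL : g.IsModGrading gL) (k : ℤ) (f : M →ₗ[S] L) : M →ₗ[S] L :=
  g.linearMapOfHom (gM.degPartAdd gL k f.toAddMonoidHom) fun i r hr x => by
    induction x using gM.induction with
    | hom j x hx =>
      rw [gM.degPartAdd_of_isHom gL _ hx, gM.degPartAdd_of_isHom gL _ (hM hr hx),
        ← hL.dec_smul hr, add_assoc]
      simp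
    | add x y hx hy => rw [smul_add, map_add, hx, hy, map_add, smul_add]

theorem degPart_of_isHom {gM : ZGrading M} {gL : ZGrading L} (hM : g.IsModGrading gM)
    (hL : g.IsModGrading gL) {k i : ℤ} (f : M →ₗ[S] L) {x : M} (hx : gM.IsHom i x) :
    degPart hM hL k f x = gL.dec (f x) (i + k) :=
  gM.degPartAdd_of_isHom gL _ hx

theorem isHomMap_degPart {gM : ZGrading M} {gL : ZGrading L} (hM : g.IsModGrading gM)
    (hL : g.IsModGrading gL) (k : ℤ) (f : M →ₗ[S] L) :
    gM.IsHomMap gL k (degPart hM hL k f).toAddMonoidHom :=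
  gM.isHomMap_degPartAdd gL k _

end RingZGrading

/-- `N ⊗ ℤ[t, t⁻¹]`, on which a homogeneous scalar `r` of degree `j` acts by
`r • (n t ^ i) = (r • n) t ^ (i + j)`. -/
def Laurent (_g : RingZGrading S) (N : Type*) [AddCommGroup N] : Type _ := ℤ →₀ N

namespace Laurent

noncomputable instance : AddCommGroup (Laurent g N) := inferInstanceAs (AddCommGroup (ℤ →₀ N))

variable (N) in
/-- The element `n t ^ i`. -/
noncomputable def single (i : ℤ) : N →+ Laurent g N := Finsupp.singleAddHom i

/-- The coefficient of `t ^ i`. -/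
noncomputable def coeff (i : ℤ) : Laurent g N →+ N := Finsupp.applyAddHom i

/-- The additive map with given restrictions to the summands `N t ^ i`. -/
noncomputable def lift {X : Type*} [AddCommGroup X] (f : ℤ → N →+ X) : Laurent g N →+ X :=
  Finsupp.liftAddHom f

@[simp]
theorem lift_single {X : Type*} [AddCommGroup X] (f : ℤ → N →+ X) (i : ℤ) (n : N) :
    lift g f (single g N i n) = f i n := Finsupp.liftAddHom_apply_single f i n

@[simp]
theorem coeff_single_self (i : ℤ) (n : N) : coeff g i (single g N i n) = n :=
  Finsupp.single_eq_same

theorem coeff_single_of_ne {i j : ℤ} (h : j ≠ i) (n : N) : coeff g j (single g N i n) = 0 :=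
  Finsupp.single_eq_of_ne h

variable {g}

theorem induction {p : Laurent g N → Prop} (hs : ∀ i n, p (single g N i n))
    (ha : ∀ x y, p x → p y → p (x + y)) (x : Laurent g N) : p x :=
  have h0 : p (0 : Laurent g N) := map_zero (single g N 0) ▸ hs 0 0
  Finsupp.induction_linear (motive := p) x h0 ha hs

theorem addHom_ext {X : Type*} [AddCommGroup X] {f f' : Laurent g N →+ X}
    (h : ∀ i n, f (single g N i n) = f' (single g N i n)) : f = f' :=
  Finsupp.addHom_ext h

theorem coeff_ext {x y : Laurent g N} (h : ∀ i, coeff g i x = coeff g i y) : x = y :=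
  Finsupp.ext h

variable (g N) in
/-- The grading of `N ⊗ ℤ[t, t⁻¹]` by the exponent of `t`. -/
noncomputable def grading : ZGrading (Laurent g N) where
  dec := lift g fun i => (Finsupp.singleAddHom i).comp (single g N i)
  dec_dec x i := by
    induction x using induction with
    | hs j n =>
      simp only [lift_single, AddMonoidHom.comp_apply, Finsupp.singleAddHom_apply]
      by_cases h : j = i
      · subst h; simp
      · simp [Finsupp.single_eq_of_ne (Ne.symm h)]
    | ha x y hx hy => simp only [map_add, Finsupp.add_apply, hx, hy, Finsupp.single_add]
  sum_dec x := by
    induction x using induction with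
    | hs j n => simp
    | ha x y hx hy =>
      rw [map_add, Finsupp.sum_add_index' (fun _ => rfl) (fun _ _ _ => rfl), hx, hy]

theorem isHom_single (i : ℤ) (n : N) : (grading g N).IsHom i (single g N i n) := by
  simp [ZGrading.IsHom, grading]

theorem grading_dec (x : Laurent g N) (i : ℤ) :
    (grading g N).dec x i = single g N i (coeff g i x) := by
  induction x using induction with
  | hs j n =>
    rw [isHom_single j n]
    by_cases h : j = i
    · subst h; simp
    · rw [Finsupp.single_eq_of_ne (Ne.symm h), coeff_single_of_ne g (Ne.symm h), map_zero]
  | ha x y hx hy => rw [map_add, Finsupp.add_apply, hx, hy, map_add, map_add]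

theorem eq_single_of_isHom {i : ℤ} {x : Laurent g N} (h : (grading g N).IsHom i x) :
    x = single g N i (coeff g i x) := by
  rw [← grading_dec, h.dec_self]

variable [Module S N]

variable (g) in
/-- The action of the ring, as an additive map. -/
noncomputable def act : S →+ Laurent g N →+ Laurent g N :=
  (Finsupp.liftAddHom fun j : ℤ => AddMonoidHom.mk' (fun r : S =>
    (lift g fun i => (single g N (i + j)).comp (DistribSMul.toAddMonoidHom N r) :
      Laurent g N →+ Laurent g N)) fun r s => addHom_ext fun i n => by
        simp [add_smul]).comp g.dec

theorem act_single {j : ℤ} {r : S} (hr : g.IsHom j r) (i : ℤ) (n : N) :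
    act g r (single g N i n) = single g N (i + j) (r • n) := by
  simp only [act, AddMonoidHom.comp_apply]
  rw [hr]
  simp

noncomputable instance : Module S (Laurent g N) where
  smul r x := act g r x
  one_smul x := by
    change act g 1 x = x
    induction x using induction with
    | hs i n => rw [act_single g.one_isHom]; simp
    | ha x y hx hy => rw [map_add, hx, hy]
  mul_smul r s x := by
    change act g (r * s) x = act g r (act g s x)
    induction r using g.toZGrading.induction with
    | hom i r hr =>
      induction s using g.toZGrading.induction with
      | hom j s hs =>
        induction x using induction with
        | hs k n =>
          rw [act_single (g.mul_isHom hr hs), act_single hs, act_single hr, mul_smul, add_comm i j,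
            add_assoc]
        | ha x y hx hy => rw [map_add, map_add, map_add, hx, hy]
      | add s s' h h' => rw [mul_add, map_add, AddMonoidHom.add_apply, h, h', map_add,
          AddMonoidHom.add_apply, map_add]
    | add r r' h h' => rw [add_mul, map_add, AddMonoidHom.add_apply, h, h', map_add,
        AddMonoidHom.add_apply]
  smul_zero r := map_zero _
  smul_add r := map_add _
  add_smul r s x := by
    change act g (r + s) x = act g r x + act g s x
    rw [map_add, AddMonoidHom.add_apply]
  zero_smul x := by
    change act g 0 x = 0
    rw [map_zero, AddMonoidHom.zero_apply]

theorem smul_single {j : ℤ} {r : S} (hr : g.IsHom j r) (i : ℤ) (n : N) :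
    r • single g N i n = single g N (i + j) (r • n) := act_single hr i n

theorem coeff_smul {j : ℤ} {r : S} (hr : g.IsHom j r) (x : Laurent g N) (i : ℤ) :
    coeff g (i + j) (r • x) = r • coeff g i x := by
  induction x using induction with
  | hs k n =>
    rw [smul_single hr]
    by_cases h : i = k
    · subst h; simp
    · rw [coeff_single_of_ne g h, coeff_single_of_ne g (by omega), smul_zero]
  | ha x y hx hy => rw [smul_add, map_add, hx, hy, map_add, smul_add]

theorem isModGrading : g.IsModGrading (grading g N) := by
  intro i j r m hr hm
  rw [eq_single_of_isHom hm, smul_single hr, add_comm]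
  exact isHom_single _ _

variable (g N) in
/-- Multiplication by `t ^ k`. -/
noncomputable def shift (k : ℤ) : Laurent g N →ₗ[S] Laurent g N :=
  g.linearMapOfHom (lift g fun i => single g N (i + k)) fun j r hr x => by
    induction x using induction with
    | hs i n =>
      rw [smul_single hr, lift_single, lift_single, smul_single hr, add_right_comm]
    | ha x y hx hy => rw [smul_add, map_add, hx, hy, map_add, smul_add]

@[simp]
theorem shift_single (k i : ℤ) (n : N) : shift g N k (single g N i n) = single g N (i + k) n :=
  lift_single _ _ _ _

variable (g N) in
/-- The evaluation at `t = 1`. -/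
noncomputable def eval : Laurent g N →ₗ[S] N :=
  g.linearMapOfHom (lift g fun _ => AddMonoidHom.id N) fun j r hr x => by
    induction x using induction with
    | hs i n => rw [smul_single hr, lift_single, lift_single]; rfl
    | ha x y hx hy => rw [smul_add, map_add, hx, hy, map_add, smul_add]

@[simp]
theorem eval_single (i : ℤ) (n : N) : eval g N (single g N i n) = n :=
  lift_single _ _ _ _

variable (g) in
/-- The map induced by a linear map. -/
noncomputable def map (f : M →ₗ[S] N) : Laurent g M →ₗ[S] Laurent g N :=
  g.linearMapOfHom (lift g fun i => (single g N i).comp f.toAddMonoidHom) fun j r hr x => by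
    induction x using induction with
    | hs i n =>
      rw [smul_single hr, lift_single, lift_single]
      simp [smul_single hr]
    | ha x y hx hy => rw [smul_add, map_add, hx, hy, map_add, smul_add]

@[simp]
theorem map_single (f : M →ₗ[S] N) (i : ℤ) (n : M) :
    map g f (single g M i n) = single g N i (f n) :=
  lift_single _ _ _ _

/-- The linear map `M → M ⊗ ℤ[t, t⁻¹]` that describes a grading. -/
noncomputable def coact {gM : ZGrading M} (h : g.IsModGrading gM) : M →ₗ[S] Laurent g M :=
  g.linearMapOfHom (show M →+ Laurent g M from gM.dec) fun j r hr x => by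
    refine coeff_ext fun i => ?_
    have h1 := coeff_smul hr (show Laurent g M from gM.dec x) (i - j)
    rw [sub_add_cancel] at h1
    exact (h.dec_smul' hr x i).trans h1.symm

theorem coact_of_isHom {gM : ZGrading M} (h : g.IsModGrading gM) {i : ℤ} {x : M}
    (hx : gM.IsHom i x) : coact h x = single g M i x := hx

end Laurent

end GradedModules

/-! ### Finite support of finitely generated graded modules -/

section FiniteSupport

variable {S : Type*} [Ring S] {g : RingZGrading S}

/-- A homogeneous submodule contains the homogeneous components of its elements. -/
def ZGrading.IsHomSub {M : Type*} [AddCommGroup M] [Module S M] (gM : ZGrading M)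
    (A : Submodule S M) : Prop := ∀ x ∈ A, ∀ i, gM.dec x i ∈ A

namespace ZGrading.IsHomSub

variable {M : Type*} [AddCommGroup M] [Module S M] {gM : ZGrading M} {A : Submodule S M}

/-- The grading of a homogeneous submodule. -/
noncomputable def subGrading (h : gM.IsHomSub A) : ZGrading A :=
  gM.ofInjective A.subtype.toAddMonoidHom A.injective_subtype
    fun x i => ⟨⟨_, h x x.2 i⟩, rfl⟩

theorem subGrading_isHom_iff (h : gM.IsHomSub A) {x : A} {i : ℤ} :
    h.subGrading.IsHom i x ↔ gM.IsHom i (x : M) :=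
  gM.ofInjective_isHom_iff _ _ _ _ _

theorem isModGrading_subGrading (h : gM.IsHomSub A) (hg : g.IsModGrading gM) :
    g.IsModGrading h.subGrading :=
  hg.ofInjective A.subtype _ _

theorem mkQ_ker (h : gM.IsHomSub A) (x : M) (hx : A.mkQ.toAddMonoidHom x = 0) (i : ℤ) :
    A.mkQ.toAddMonoidHom (gM.dec x i) = 0 :=
  (Submodule.Quotient.mk_eq_zero A).2 (h x ((Submodule.Quotient.mk_eq_zero A).1 hx) i)

/-- The grading of the quotient by a homogeneous submodule. -/
noncomputable def quotGrading (h : gM.IsHomSub A) : ZGrading (M ⧸ A) :=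
  gM.ofSurjective A.mkQ.toAddMonoidHom A.mkQ_surjective h.mkQ_ker

theorem isHomMap_mkQ (h : gM.IsHomSub A) :
    gM.IsHomMap h.quotGrading 0 A.mkQ.toAddMonoidHom :=
  gM.ofSurjective_isHomMap _ _ _

theorem isModGrading_quotGrading (h : gM.IsHomSub A) (hg : g.IsModGrading gM) :
    g.IsModGrading h.quotGrading :=
  hg.ofSurjective A.mkQ _ _

end ZGrading.IsHomSub

section
variable {M L : Type*} [AddCommGroup M] [Module S M] [AddCommGroup L] [Module S L]
  {gM : ZGrading M} {gL : ZGrading L}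

theorem ZGrading.IsHomMap.isHomSub_ker {k : ℤ} {f : M →ₗ[S] L}
    (h : gM.IsHomMap gL k f.toAddMonoidHom) : gM.IsHomSub (LinearMap.ker f) := by
  intro x hx i
  have := h.dec_apply x i
  rw [LinearMap.mem_ker]
  rw [show f.toAddMonoidHom x = 0 from hx] at this
  simpa using this.symm

theorem ZGrading.IsHomMap.isHomSub_range {k : ℤ} {f : M →ₗ[S] L}
    (h : gM.IsHomMap gL k f.toAddMonoidHom) : gL.IsHomSub (LinearMap.range f) := by
  rintro _ ⟨x, rfl⟩ i
  exact ⟨gM.dec x (i - k), (h.dec_apply' x i).symm⟩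

theorem ZGrading.IsHomMap.isHomSub_map {k : ℤ} {f : M →ₗ[S] L}
    (h : gM.IsHomMap gL k f.toAddMonoidHom) {A : Submodule S M} (hA : gM.IsHomSub A) :
    gL.IsHomSub (A.map f) := by
  rintro _ ⟨x, hx, rfl⟩ i
  exact ⟨gM.dec x (i - k), hA x hx _, (h.dec_apply' x i).symm⟩

/-- A homogeneous endomorphism of nonzero degree of a nonzero graded artinian module is not
injective. -/
theorem ZGrading.IsHomMap.not_injective [IsArtinian S M] {k : ℤ} (hk : k ≠ 0) {ψ : M →ₗ[S] M}
    (hψ : gM.IsHomMap gM k ψ.toAddMonoidHom) [Nontrivial M] : ¬ Function.Injective ψ := by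
  intro hinj
  have hnz : ∀ x, x ≠ 0 → ψ x ≠ 0 := fun x hx h => hx (hinj (by rw [h, map_zero]))
  have hinf : ∀ (x : M) (f : ℕ → ℤ), Function.Injective f → (∀ n, gM.dec x (f n) ≠ 0) → False := by
    intro x f hf h
    have : Set.Infinite (Set.range f) := Set.infinite_range_of_injective hf
    refine this (Set.Finite.subset (gM.dec x).support.finite_toSet ?_)
    rintro _ ⟨n, rfl⟩
    simpa using h n
  -- If each component of `x` is determined from the one `k` degrees before by `ψ`, except possibly
  -- in degree `d`, then a nonzero component in degree `d` would propagate forever in steps of `k`.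
  have hup : ∀ x : M, ∀ d, (∀ i, gM.dec x (i + k) ≠ ψ (gM.dec x i) → i + k = d) →
      gM.dec x d = 0 := by
    intro x d hx
    by_contra h0
    refine hinf x (fun n => d + n * k) ?_ ?_
    · intro a b hab
      have : (a : ℤ) * k = b * k := by simpa using hab
      exact_mod_cast mul_right_cancel₀ hk this
    · intro n
      induction n with
      | zero => simpa using h0
      | succ n ih =>
        have h1 : d + ((n + 1 : ℕ) : ℤ) * k = d + n * k + k := by push_cast; ring
        rw [h1]
        by_cases h2 : gM.dec x (d + n * k + k) = ψ (gM.dec x (d + n * k))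
        · rw [h2]
          exact hnz _ ih
        · rw [hx _ h2]
          exact h0
  have hinj1 : Function.Injective (LinearMap.id - ψ : M →ₗ[S] M) := by
    rw [injective_iff_map_eq_zero]
    intro x hx
    have hx : x = ψ x := sub_eq_zero.1 hx
    refine gM.eq_zero_of_dec fun i => hup x i fun j hj => ?_
    exact absurd (by conv_lhs => rw [hx]
                     exact hψ.dec_apply x j) hj
  -- Over an artinian module `1 - ψ` is now surjective. Solving `x = a + ψ x` with `a` homogeneous
  -- and nonzero gives a contradiction: `x` vanishes in degree `j` by `hup`, so `ψ` of its component
  -- in degree `j - k` is `-a`, and nonzero components then continue backwards without end.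
  have hsurj := IsArtinian.surjective_of_injective_endomorphism _ hinj1
  obtain ⟨y, hy⟩ := exists_ne (0 : M)
  obtain ⟨j, hj⟩ : ∃ j, gM.dec y j ≠ 0 := by
    by_contra! h
    exact hy (gM.eq_zero_of_dec h)
  set a := gM.dec y j with ha
  have haj : gM.IsHom j a := gM.isHom_dec _ _
  obtain ⟨x, hx⟩ := hsurj a
  have hx : x = a + ψ x := by
    rw [← hx]
    simp
  have hdec : ∀ i, gM.dec x (i + k) = gM.dec a (i + k) + ψ (gM.dec x i) := by
    intro i
    conv_lhs => rw [hx]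
    rw [map_add gM.dec, Finsupp.add_apply]
    congr 1
    exact hψ.dec_apply x i
  have hxj : gM.dec x j = 0 := by
    refine hup x j fun i hi => ?_
    by_contra h
    rw [hdec, haj.dec_of_ne (Ne.symm h), zero_add] at hi
    exact hi rfl
  refine hinf x (fun n => j - (n + 1) * k) ?_ ?_
  · intro a b hab
    have : ((a : ℤ) + 1) * k = (b + 1) * k := by simpa using hab
    have := mul_right_cancel₀ hk this
    omega
  · intro n
    induction n with
    | zero =>
      intro h0
      have := hdec (j - k)
      rw [sub_add_cancel, hxj, haj.dec_self] at this
      simp only [Nat.cast_zero, zero_add, one_mul] at h0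
      rw [h0, map_zero, add_zero] at this
      exact hj this.symm
    | succ n ih =>
      intro h0
      have h1 : j - ((n : ℤ) + 1) * k = j - (((n + 1 : ℕ) : ℤ) + 1) * k + k := by push_cast; ring
      rw [h1, hdec, h0, map_zero, add_zero] at ih
      refine ih (haj.dec_of_ne ?_)
      rw [← h1]
      intro h
      have : ((n : ℤ) + 1) * k = 0 := by linarith
      rcases mul_eq_zero.1 this with h | h
      · omega
      · exact hk h

end

/-- The left ideal of the elements that annihilate a family of elements. -/
def annihilatorOf {M : Type*} [AddCommGroup M] [Module S M] {ι : Type*} (a : ι → M)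
    (T : Finset ι) : Ideal S := ⨅ i ∈ T, LinearMap.ker (LinearMap.toSpanSingleton S M (a i))

theorem mem_annihilatorOf {M : Type*} [AddCommGroup M] [Module S M] {ι : Type*} {a : ι → M}
    {T : Finset ι} {r : S} : r ∈ annihilatorOf a T ↔ ∀ i ∈ T, r • a i = 0 := by
  simp [annihilatorOf, Submodule.mem_iInf]

theorem isHomSub_annihilatorOf {M : Type*} [AddCommGroup M] [Module S M] {gM : ZGrading M}
    (hM : g.IsModGrading gM) {a : ℤ → M} (ha : ∀ i, gM.IsHom i (a i)) (T : Finset ℤ) :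
    g.IsHomSub (annihilatorOf a T) := by
  intro r hr l
  rw [mem_annihilatorOf] at hr ⊢
  intro i hi
  have : g.IsHomMap gM i (LinearMap.toSpanSingleton S M (a i)).toAddMonoidHom := by
    intro j s hs
    exact hM hs (ha i)
  have h2 := this.dec_apply r l
  rw [show (LinearMap.toSpanSingleton S M (a i)).toAddMonoidHom r = 0 from hr i hi] at h2
  simpa using h2.symm

/-- The conclusion says that `r • a i ↦ r • a j`, for `r` in the annihilator of the other elements,
is a well-defined nonzero map. It comes from a minimal finite dependence among annihilators. -/
theorem exists_annihilatorOf_not_le {M : Type*} [AddCommGroup M] [Module S M] [IsArtinianRing S]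
    {D : Set ℤ} (hD : D.Infinite) {a : ℤ → M} (ha : ∀ i ∈ D, a i ≠ 0) :
    ∃ (i j : ℤ) (T : Finset ℤ), i ∈ D ∧ j ∈ D ∧ i ≠ j ∧
      (∃ r ∈ annihilatorOf (S := S) a T, r • a j ≠ 0) ∧
      ∀ r ∈ annihilatorOf (S := S) a T, r • a i = 0 → r • a j = 0 := by
  classical
  -- The annihilator of `T` is minimal, so it must already kill `a j` for every `j` of `D` outside
  -- `T`.
  obtain ⟨_, ⟨T, hTD, rfl⟩, hT⟩ := WellFounded.has_min (r := ((· < ·) : Ideal S → Ideal S → Prop))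
    wellFounded_lt {I | ∃ T : Finset ℤ, (T : Set ℤ) ⊆ D ∧ annihilatorOf a T = I}
    ⟨_, ∅, by simp, rfl⟩
  obtain ⟨j, hjD, hjT⟩ := hD.exists_notMem_finset T
  have hann : ∀ r ∈ annihilatorOf (S := S) a T, r • a j = 0 := by
    have hle : annihilatorOf (S := S) a (insert j T) ≤ annihilatorOf a T := by
      intro r hr
      rw [mem_annihilatorOf] at hr ⊢
      exact fun i hi => hr i (Finset.mem_insert_of_mem hi)
    have hnlt := hT _ ⟨insert j T, by
      simpa [Set.insert_subset_iff] using ⟨hjD, hTD⟩, rfl⟩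
    have heq := eq_of_le_of_not_lt hle hnlt
    intro r hr
    rw [← heq, mem_annihilatorOf] at hr
    exact hr j (Finset.mem_insert_self _ _)
  -- Take `U` minimal in `T` such that its annihilator kills `a j`. It is nonempty because `a j ≠
  -- 0`; removing any `i` from it gives the required set.
  let P : Finset ℤ → Prop := fun U => ∀ r ∈ annihilatorOf (S := S) a U, r • a j = 0
  obtain ⟨U, hUT, hU⟩ := exists_minimal_le_of_wellFoundedLT P T hann
  have hUne : U.Nonempty := by
    rw [Finset.nonempty_iff_ne_empty]
    rintro rfl
    have := hU.prop 1 (by rw [mem_annihilatorOf]; simp)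
    exact ha j hjD (by simpa using this)
  obtain ⟨i, hi⟩ := hUne
  refine ⟨i, j, U.erase i, hTD (hUT hi), hjD, fun h => hjT (h ▸ hUT hi), ?_, ?_⟩
  · by_contra! h
    have := hU.le_of_le (y := U.erase i) h (Finset.erase_subset _ _) hi
    simp at this
  · intro r hr hri
    refine hU.prop r ?_
    rw [mem_annihilatorOf] at hr ⊢
    intro l hl
    by_cases h : l = i
    · rw [h, hri]
    · exact hr l (Finset.mem_erase.2 ⟨h, hl⟩)

/-- With infinite support, nonzero homogeneous elements `a i` and `a j` of different degrees and a
homogeneous left ideal `K` can be found with `K a i = M = K a j`, so that `r • a i ↦ r • a j` is a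
surjective endomorphism of degree `j - i`. Finite length makes it injective, against
`ZGrading.IsHomMap.not_injective`. -/
theorem exists_support_of_simple [IsArtinianRing S] {M : Type*} [AddCommGroup M] [Module S M]
    [IsArtinian S M] [IsNoetherian S M] {gM : ZGrading M} (hM : g.IsModGrading gM)
    (hsimple : ∀ A : Submodule S M, gM.IsHomSub A → A = ⊥ ∨ A = ⊤) :
    ∃ F : Finset ℤ, ∀ i x, gM.IsHom i x → x ≠ 0 → i ∈ F := by
  by_contra! H
  let D : Set ℤ := {i | ∃ x, gM.IsHom i x ∧ x ≠ 0}
  have hD : D.Infinite := by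
    intro hfin
    obtain ⟨i, x, hx, hx0, hi⟩ := H hfin.toFinset
    exact hi (hfin.mem_toFinset.2 ⟨x, hx, hx0⟩)
  have : ∀ i, ∃ x, gM.IsHom i x ∧ (i ∈ D → x ≠ 0) := by
    intro i
    by_cases hi : i ∈ D
    · obtain ⟨x, hx, hx0⟩ := hi
      exact ⟨x, hx, fun _ => hx0⟩
    · exact ⟨0, gM.isHom_zero i, fun h => absurd h hi⟩
  choose a ha ha0 using this
  obtain ⟨i, j, T, hi, hj, hij, ⟨r₀, hr₀, hr₀j⟩, hT⟩ :=
    exists_annihilatorOf_not_le (S := S) hD (fun i hi => ha0 i hi)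
  let K := annihilatorOf (S := S) a T
  have hK : g.IsHomSub K := isHomSub_annihilatorOf hM ha T
  have hspan : ∀ l, g.IsHomMap gM l (LinearMap.toSpanSingleton S M (a l)).toAddMonoidHom :=
    fun l j s hs => hM hs (ha l)
  let u : K →ₗ[S] M := LinearMap.toSpanSingleton S M (a i) ∘ₗ K.subtype
  let v : K →ₗ[S] M := LinearMap.toSpanSingleton S M (a j) ∘ₗ K.subtype
  have htop : ∀ l, (∃ r ∈ K, r • a l ≠ 0) →
      LinearMap.range (LinearMap.toSpanSingleton S M (a l) ∘ₗ K.subtype) = ⊤ := by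
    rintro l ⟨r, hr, hr0⟩
    rw [LinearMap.range_comp, Submodule.range_subtype]
    refine (hsimple _ ((hspan l).isHomSub_map hK)).resolve_left fun h => hr0 ?_
    have : r • a l ∈ Submodule.map (LinearMap.toSpanSingleton S M (a l)) K := ⟨r, hr, rfl⟩
    rwa [h] at this
  have hu : Function.Surjective u :=
    LinearMap.range_eq_top.1 (htop i ⟨r₀, hr₀, fun h => hr₀j (hT _ hr₀ h)⟩)
  have hv : Function.Surjective v := LinearMap.range_eq_top.1 (htop j ⟨r₀, hr₀, hr₀j⟩)
  have hle : LinearMap.ker u ≤ LinearMap.ker v := fun r hr => hT r r.2 hr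
  let ψ : M →ₗ[S] M := (LinearMap.ker u).liftQ v hle ∘ₗ (u.quotKerEquivOfSurjective hu).symm
  have hψ : ∀ r : K, ψ (u r) = v r := by
    intro r
    have : (u.quotKerEquivOfSurjective hu).symm (u r) = Submodule.Quotient.mk r := by
      rw [LinearEquiv.symm_apply_eq]
      rfl
    simp [ψ, this]
  have hψs : Function.Surjective ψ := fun y => by
    obtain ⟨r, rfl⟩ := hv y
    exact ⟨u r, hψ r⟩
  have hψh : gM.IsHomMap gM (j - i) ψ.toAddMonoidHom := by
    intro d y hy
    obtain ⟨r, rfl⟩ := hu y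
    -- A homogeneous `y = r • a i` of degree `d` is already obtained from the component of `r` of
    -- degree `d - i`.
    let r' : K := ⟨g.dec (r : S) (d - i), hK r r.2 _⟩
    have h1 : u r = u r' := by
      have := (hspan i).dec_apply' (r : S) d
      rw [show (LinearMap.toSpanSingleton S M (a i)).toAddMonoidHom (r : S) = u r from rfl,
        hy.dec_self] at this
      exact this
    rw [h1]
    have h2 : ψ.toAddMonoidHom (u r') = g.dec (r : S) (d - i) • a j := hψ r'
    rw [h2, show d + (j - i) = (d - i) + j by ring]
    exact hM (g.isHom_dec _ _) (ha j)
  have : Nontrivial M := ⟨⟨_, 0, hr₀j⟩⟩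
  exact hψh.not_injective (sub_ne_zero.2 hij.symm)
    (IsNoetherian.injective_of_surjective_endomorphism ψ hψs)

/-- A graded module of finite length over a graded left artinian ring has finite support. -/
theorem exists_support_of_length [IsArtinianRing S] (n : ℕ∞) :
    ∀ (M : Type w) [AddCommGroup M] [Module S M] [IsArtinian S M] [IsNoetherian S M]
    (gM : ZGrading M), g.IsModGrading gM → Module.length S M = n →
    ∃ F : Finset ℤ, ∀ i x, gM.IsHom i x → x ≠ 0 → i ∈ F := by
  classical
  induction n using WellFoundedLT.induction with
  | ind n ih =>
  intro M _ _ _ _ gM hM hn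
  by_cases hsimple : ∀ A : Submodule S M, gM.IsHomSub A → A = ⊥ ∨ A = ⊤
  · exact exists_support_of_simple hM hsimple
  push Not at hsimple
  -- A proper nonzero graded submodule and its quotient are shorter, and the union of their supports
  -- contains that of `M`.
  obtain ⟨A, hA, hbot, htop⟩ := hsimple
  obtain ⟨F, hF⟩ := ih _ (hn ▸ Submodule.length_lt htop) A hA.subGrading
    (hA.isModGrading_subGrading hM) rfl
  obtain ⟨F', hF'⟩ := ih _ (hn ▸ Submodule.length_quotient_lt A hbot) (M ⧸ A) hA.quotGrading
    (hA.isModGrading_quotGrading hM) rfl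
  refine ⟨F ∪ F', fun i x hx hx0 => ?_⟩
  by_cases hxA : x ∈ A
  · exact Finset.mem_union_left _ (hF i ⟨x, hxA⟩ (hA.subGrading_isHom_iff.2 hx)
      fun h => hx0 (congrArg Subtype.val h))
  · refine Finset.mem_union_right _ (hF' i (A.mkQ x) ?_ ?_)
    · have := hA.isHomMap_mkQ i x hx
      rwa [add_zero] at this
    · exact fun h => hxA ((Submodule.Quotient.mk_eq_zero A).1 h)

theorem exists_support [IsArtinianRing S] {M : Type*} [AddCommGroup M] [Module S M]
    [Module.Finite S M] {gM : ZGrading M} (hM : g.IsModGrading gM) :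
    ∃ F : Finset ℤ, ∀ i x, gM.IsHom i x → x ≠ 0 → i ∈ F :=
  exists_support_of_length _ M gM hM rfl

end FiniteSupport

/-! ### A graded Harada-Sai lemma -/

section HaradaSai

open scoped Pointwise

variable {S : Type*} [Ring S] {g : RingZGrading S}
variable {M L N : Type*} [AddCommGroup M] [Module S M] [AddCommGroup L] [Module S L]
  [AddCommGroup N] [Module S N] {gM : ZGrading M} {gL : ZGrading L} {gN : ZGrading N}

theorem ZGrading.IsHomMap.comp {j k : ℤ} {f : M →+ L} {f' : L →+ N} (hf' : gL.IsHomMap gN k f')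
    (hf : gM.IsHomMap gL j f) : gM.IsHomMap gN (j + k) (f'.comp f) := by
  intro i x hx
  rw [← add_assoc]
  exact hf' _ _ (hf _ _ hx)

theorem ZGrading.isHomMap_id : gM.IsHomMap gM 0 (LinearMap.id : M →ₗ[S] M).toAddMonoidHom := by
  intro i x hx
  rw [add_zero]
  exact hx

/-- A graded module is graded-indecomposable if its only homogeneous direct summands are
the trivial ones. -/
def ZGrading.IsIndecomposable (S : Type*) [Ring S] {M : Type*} [AddCommGroup M] [Module S M]
    (gM : ZGrading M) : Prop :=
  ∀ A B : Submodule S M, gM.IsHomSub A → gM.IsHomSub B → IsCompl A B → A = ⊥ ∨ A = ⊤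

/-- The homogeneous endomorphisms (of any degree) that are not injective. -/
def ZGrading.nonInjective (S : Type*) [Ring S] {M : Type*} [AddCommGroup M] [Module S M]
    (gM : ZGrading M) : Set (Module.End S M) :=
  {f | (∃ k, gM.IsHomMap gM k f.toAddMonoidHom) ∧ ¬ Function.Injective f}

theorem ZGrading.exists_isHomMap_of_mem_pow {n : ℕ} {f : Module.End S M}
    (hf : f ∈ gM.nonInjective S ^ n) : ∃ k, gM.IsHomMap gM k f.toAddMonoidHom := by
  induction n generalizing f with
  | zero =>
    rw [pow_zero, Set.mem_one] at hf
    subst hf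
    exact ⟨0, ZGrading.isHomMap_id⟩
  | succ n ih =>
    rw [pow_succ] at hf
    obtain ⟨p, hp, q, hq, rfl⟩ := Set.mem_mul.1 hf
    obtain ⟨k, hk⟩ := ih hp
    obtain ⟨j, hj⟩ := hq.1
    exact ⟨j + k, hk.comp hj⟩

theorem Submodule.length_mono {A B : Submodule S M} (h : A ≤ B) :
    Module.length S A ≤ Module.length S B :=
  Module.length_le_of_injective (Submodule.inclusion h) (Submodule.inclusion_injective h)

theorem Submodule.eq_of_le_of_length_le [IsArtinian S M] [IsNoetherian S M] {A B : Submodule S M}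
    (h : A ≤ B) (hl : Module.length S B ≤ Module.length S A) : A = B := by
  refine eq_of_le_of_not_lt h fun hlt => ?_
  have := Submodule.height_strictMono hlt
  rw [← Module.length_submodule, ← Module.length_submodule] at this
  exact absurd hl (not_le.2 this)

theorem disjoint_ker_of_length_le [IsArtinian S M] [IsNoetherian S M] {f : M →ₗ[S] L}
    {A : Submodule S M} (h : Module.length S A ≤ Module.length S (A.map f)) :
    Disjoint A (LinearMap.ker f) := by
  have hbot : LinearMap.ker (f.domRestrict A) = ⊥ := by
    by_contra hne
    have h1 := Submodule.length_quotient_lt _ hne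
    rw [(f.domRestrict A).quotKerEquivRange.length_eq, LinearMap.range_domRestrict] at h1
    exact absurd h (not_le.2 h1)
  rw [Submodule.disjoint_def]
  intro x hx hfx
  have : (⟨x, hx⟩ : A) ∈ LinearMap.ker (f.domRestrict A) := by simpa using hfx
  rw [hbot] at this
  exact congrArg Subtype.val ((Submodule.mem_bot S).1 this)

/-- The graded form of the Harada-Sai lemma. -/
theorem ZGrading.IsIndecomposable.length_range_add_le [IsArtinian S M] [IsNoetherian S M]
    (hM : gM.IsIndecomposable S) (m : ℕ) {f : Module.End S M}
    (hf : f ∈ gM.nonInjective S ^ (2 ^ m - 1)) :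
    f = 0 ∨ Module.length S (LinearMap.range f) + m ≤ Module.length S M := by
  induction m generalizing f with
  | zero =>
    right
    simpa using Module.length_le_of_injective _ (LinearMap.range f).injective_subtype
  | succ m ih =>
    -- A product of this length splits as `p * h * q` with `h` a single factor and `p`, `q` products
    -- of the previous length.
    have hpow : 2 ^ (m + 1) - 1 = (2 ^ m - 1) + 1 + (2 ^ m - 1) := by
      have := Nat.one_le_two_pow (n := m)
      rw [pow_succ]
      omega
    rw [hpow, pow_add, pow_succ] at hf
    obtain ⟨p', hp', q, hq, rfl⟩ := Set.mem_mul.1 hf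
    obtain ⟨p, hp, h, hh, rfl⟩ := Set.mem_mul.1 hp'
    by_cases h0 : p * h * q = 0
    · exact Or.inl h0
    right
    have hp0 : p ≠ 0 := fun h => h0 (by rw [h, zero_mul, zero_mul])
    have hq0 : q ≠ 0 := fun h => h0 (by rw [h, mul_zero])
    have lp := (ih hp).resolve_left hp0
    have lq := (ih hq).resolve_left hq0
    by_contra hcon
    have l1 : Module.length S (LinearMap.range (p * h)) ≤ Module.length S (LinearMap.range p) :=
      Submodule.length_mono (LinearMap.range_comp_le_range h p)
    have hmap : LinearMap.range (p * h * q) = (LinearMap.range q).map (p * h) :=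
      LinearMap.range_comp q (p * h)
    have hfin : ∀ A : Submodule S M, ∃ n : ℕ, (n : ℕ∞) = Module.length S A := fun A =>
      ENat.ne_top_iff_exists.1 Module.length_ne_top
    obtain ⟨n, hn⟩ := ENat.ne_top_iff_exists.1 (Module.length_ne_top (R := S) (M := M))
    obtain ⟨a, ha⟩ := hfin (LinearMap.range (p * h * q))
    obtain ⟨b, hb⟩ := hfin (LinearMap.range p)
    obtain ⟨c, hc⟩ := hfin (LinearMap.range q)
    obtain ⟨d, hd⟩ := hfin (LinearMap.range (p * h))
    rw [← hb, ← hn] at lp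
    rw [← hc, ← hn] at lq
    rw [← hd, ← hb] at l1
    rw [← ha, ← hn] at hcon
    norm_cast at lp lq l1 hcon
    -- If the bound for `m + 1` fails, the ranges of `q`, `p * h` and `p * h * q` all have length `n
    -- - m`. Hence `p * h` is injective on the range of `q` and has the same image on it as on `M`,
    -- which makes the range of `q` a graded complement of the kernel of `p * h`.
    have hdisj : Disjoint (LinearMap.range q) (LinearMap.ker (p * h)) := by
      refine disjoint_ker_of_length_le ?_
      rw [← hmap, ← ha, ← hc]
      norm_cast
      omega
    have heq : LinearMap.range (p * h * q) = LinearMap.range (p * h) := by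
      refine Submodule.eq_of_le_of_length_le (LinearMap.range_comp_le_range q (p * h)) ?_
      rw [← ha, ← hd]
      norm_cast
      omega
    have hcod : Codisjoint (LinearMap.range q) (LinearMap.ker (p * h)) := by
      rw [codisjoint_iff, eq_top_iff]
      intro x _
      have : (p * h) x ∈ LinearMap.range (p * h * q) := heq ▸ LinearMap.mem_range_self _ x
      obtain ⟨y, hy⟩ := this
      refine Submodule.mem_sup.2 ⟨q y, ⟨y, rfl⟩, x - q y, ?_, by abel⟩
      rw [LinearMap.mem_ker, map_sub, sub_eq_zero, ← hy]
      rfl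
    obtain ⟨kq, hkq⟩ := gM.exists_isHomMap_of_mem_pow hq
    obtain ⟨kp, hkp⟩ := gM.exists_isHomMap_of_mem_pow hp
    obtain ⟨kh, hkh⟩ := hh.1
    have hkph : gM.IsHomMap gM (kh + kp) (p * h).toAddMonoidHom := hkp.comp hkh
    rcases hM _ _ hkq.isHomSub_range hkph.isHomSub_ker ⟨hdisj, hcod⟩ with hr | hr
    · exact hq0 (LinearMap.range_eq_bot.1 hr)
    · rw [hr, top_disjoint] at hdisj
      have := LinearMap.ker_eq_bot.1 hdisj
      exact hh.2 (Function.Injective.of_comp (f := p) this)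

/-- Harada-Sai bounds all products of the non-injective homogeneous endomorphisms uniformly, so it
applies to every term in the expansion of a power of a sum of them, although such a sum is not
homogeneous. -/
theorem ZGrading.IsIndecomposable.isNilpotent [IsArtinian S M] [IsNoetherian S M]
    (hM : gM.IsIndecomposable S) {f : Module.End S M}
    (hf : f ∈ AddSubmonoid.closure (gM.nonInjective S)) : IsNilpotent f := by
  obtain ⟨n, hn⟩ := ENat.ne_top_iff_exists.1 (Module.length_ne_top (R := S) (M := M))
  -- With `n` the length of `M`, a nonzero product of this many factors would have a range of length
  -- at most `n - (n + 1)`.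
  refine ⟨2 ^ (n + 1) - 1, ?_⟩
  have h1 : ∀ k, f ^ k ∈ AddSubmonoid.closure (gM.nonInjective S) ^ k := by
    intro k
    induction k with
    | zero => rw [pow_zero, pow_zero]; exact AddSubmonoid.mem_one.2 ⟨1, by simp⟩
    | succ k ih => rw [pow_succ, pow_succ]; exact AddSubmonoid.mul_mem_mul ih hf
  replace h1 := h1 (2 ^ (n + 1) - 1)
  rw [AddSubmonoid.closure_pow] at h1
  have h2 : AddSubmonoid.closure (gM.nonInjective S ^ (2 ^ (n + 1) - 1)) ≤ ⊥ := by
    rw [AddSubmonoid.closure_le]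
    intro x hx
    rcases hM.length_range_add_le (n + 1) hx with h | h
    · exact h
    · rw [← hn] at h
      have h3 : ((n + 1 : ℕ) : ℕ∞) ≤ n := le_trans le_add_self h
      norm_cast at h3
      omega
  exact h2 h1

end HaradaSai

/-! ### Splitting a graded summand of the Laurent module off `N` -/

section Splitting

variable {S : Type*} [Ring S] {g : RingZGrading S}
variable {N Y : Type*} [AddCommGroup N] [Module S N] [AddCommGroup Y] [Module S Y]
  {gY : ZGrading Y}

theorem Laurent.isHomMap_shift (k : ℤ) : (Laurent.grading g N).IsHomMap (Laurent.grading g N) k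
    (Laurent.shift g N k).toAddMonoidHom := by
  intro i x hx
  rw [Laurent.eq_single_of_isHom hx]
  have : (Laurent.shift g N k).toAddMonoidHom (Laurent.single g N i (Laurent.coeff g i x)) = _ :=
    Laurent.shift_single k i _
  rw [this]
  exact Laurent.isHom_single _ _

/-- A homogeneous map from `N ⊗ ℤ[t, t⁻¹]` to a graded module of finite support induces a map
on `N`. -/
theorem Laurent.exists_sum {F : Finset ℤ}
    (hF : ∀ i y, gY.IsHom i y → y ≠ 0 → i ∈ F) (p : Laurent g N →ₗ[S] Y)
    (hp : (Laurent.grading g N).IsHomMap gY 0 p.toAddMonoidHom) :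
    ∃ b : N →ₗ[S] Y, ∀ n (K : Finset ℤ), (∀ i, p (Laurent.single g N i n) ≠ 0 → i ∈ K) →
      b n = ∑ i ∈ K, p (Laurent.single g N i n) := by
  have hsupp : ∀ i n, p (Laurent.single g N i n) ≠ 0 → i ∈ F := by
    intro i n hi
    have := hp i _ (Laurent.isHom_single i n)
    rw [add_zero] at this
    exact hF i _ this hi
  have hsum : ∀ n (K : Finset ℤ), (∀ i, p (Laurent.single g N i n) ≠ 0 → i ∈ K) →
      ∑ᶠ i, p (Laurent.single g N i n) = ∑ i ∈ K, p (Laurent.single g N i n) := fun n K hK =>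
    finsum_eq_sum_of_support_subset _ fun i hi => hK i hi
  let b : N →+ Y := ∑ i ∈ F, p.toAddMonoidHom.comp (Laurent.single g N i)
  have hb : ∀ n, b n = ∑ᶠ i, p (Laurent.single g N i n) := by
    intro n
    rw [hsum n F fun i => hsupp i n]
    simp [b]
  refine ⟨g.linearMapOfHom b fun j r hr n => ?_, fun n K hK => ?_⟩
  · have hfin : (Function.support fun i => p (Laurent.single g N i n)).Finite :=
      F.finite_toSet.subset fun i hi => hsupp i n hi
    -- Multiplication by `r` of degree `j` moves the term of index `i - j` to index `i`, so
    -- linearity is a reindexing of the sum.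
    rw [hb, hb, smul_finsum' r hfin,
      ← finsum_comp_equiv (Equiv.subRight j)
        (f := fun i => r • p (Laurent.single g N i n))]
    refine finsum_congr fun i => ?_
    rw [Equiv.subRight_apply, ← map_smul, Laurent.smul_single hr, sub_add_cancel]
  · exact (hb n).trans (hsum n K hK)

/-- A graded-indecomposable homogeneous direct summand of `N ⊗ ℤ[t, t⁻¹]` of finite length and
finite support is a direct summand of `N`. -/
theorem Laurent.exists_retraction [IsArtinian S Y] [IsNoetherian S Y] [Nontrivial Y]
    (hind : gY.IsIndecomposable S) {F : Finset ℤ}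
    (hF : ∀ i y, gY.IsHom i y → y ≠ 0 → i ∈ F) (f : Y →ₗ[S] Laurent g N)
    (hf : gY.IsHomMap (Laurent.grading g N) 0 f.toAddMonoidHom) (p : Laurent g N →ₗ[S] Y)
    (hp : (Laurent.grading g N).IsHomMap gY 0 p.toAddMonoidHom) (hpf : ∀ y, p (f y) = y) :
    ∃ (a : Y →ₗ[S] N) (b : N →ₗ[S] Y), ∀ y, b (a y) = y := by
  classical
  obtain ⟨b, hb⟩ := Laurent.exists_sum hF p hp
  let a : Y →ₗ[S] N := Laurent.eval g N ∘ₗ f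
  let φ : ℤ → Module.End S Y := fun k => p ∘ₗ Laurent.shift g N k ∘ₗ f
  have hφ : ∀ k, gY.IsHomMap gY k (φ k).toAddMonoidHom := by
    intro k
    have := hp.comp ((Laurent.isHomMap_shift k).comp hf)
    rw [zero_add, add_zero] at this
    exact this
  -- All degrees by which a nonzero homogeneous map can move the support of `Y`, together with `0`
  -- so that the identity term can be separated.
  let K : Finset ℤ := insert 0 ((F ×ˢ F).image fun x => x.1 - x.2)
  have hba : b ∘ₗ a = ∑ k ∈ K, φ k := by
    apply LinearMap.toAddMonoidHom_injective
    refine gY.addHom_ext fun i y hy => ?_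
    change b (a y) = (∑ k ∈ K, φ k) y
    rw [LinearMap.sum_apply]
    by_cases hy0 : y = 0
    · simp [hy0]
    have hfy := hf i y hy
    rw [add_zero] at hfy
    have hfy := Laurent.eq_single_of_isHom hfy
    set n := Laurent.coeff g i (f.toAddMonoidHom y)
    have hfy : f y = Laurent.single g N i n := hfy
    have hay : a y = n := by
      simp [a, hfy]
    have hφy : ∀ k, φ k y = p (Laurent.single g N (i + k) n) := fun k => by
      simp [φ, hfy]
    simp only [hφy]
    rw [hay, hb n (K.map (addLeftEmbedding i)) ?_, Finset.sum_map]
    · rfl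
    · intro l hl
      have h1 : l ∈ F := by
        have := hp l _ (Laurent.isHom_single l n)
        rw [add_zero] at this
        exact hF l _ this hl
      have h2 : i ∈ F := hF i y hy hy0
      refine Finset.mem_map.2 ⟨l - i, ?_, by simp⟩
      exact Finset.mem_insert_of_mem (Finset.mem_image.2 ⟨(l, i), by simp [h1, h2], rfl⟩)
  have h0 : φ 0 = 1 := by
    have hs : ∀ x : Laurent g N, Laurent.shift g N 0 x = x := fun x => by
      induction x using Laurent.induction with
      | hs i n => simp
      | ha x y hx hy => rw [map_add, hx, hy]
    ext y
    simp [φ, hs, hpf]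
  have hunit : IsUnit (b ∘ₗ a : Module.End S Y) := by
    rw [hba, ← Finset.add_sum_erase K φ (Finset.mem_insert_self _ _), h0]
    -- The remaining terms have nonzero degree, hence are not injective on the artinian module `Y`,
    -- and their sum is nilpotent by Harada-Sai.
    refine IsNilpotent.isUnit_one_add (hind.isNilpotent ?_)
    refine AddSubmonoid.sum_mem _ fun k hk => AddSubmonoid.subset_closure ?_
    exact ⟨⟨k, hφ k⟩, (hφ k).not_injective (Finset.ne_of_mem_erase hk)⟩
  obtain ⟨c, hc⟩ := hunit.exists_left_inv
  exact ⟨a, c ∘ₗ b, fun y => LinearMap.congr_fun hc y⟩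

end Splitting

/-! ### Graded direct summands and local fixedness -/

section Summands

variable {S : Type*} [Ring S] {g : RingZGrading S}
variable {M L N : Type*} [AddCommGroup M] [Module S M] [AddCommGroup L] [Module S L]
  [AddCommGroup N] [Module S N] {gM : ZGrading M}

theorem ZGrading.IsHomSub.sup {A B : Submodule S M} (hA : gM.IsHomSub A) (hB : gM.IsHomSub B) :
    gM.IsHomSub (A ⊔ B) := by
  intro x hx i
  obtain ⟨a, ha, b, hb, rfl⟩ := Submodule.mem_sup.1 hx
  rw [map_add, Finsupp.add_apply]
  exact Submodule.add_mem_sup (hA a ha i) (hB b hb i)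

theorem RingZGrading.IsModGrading.isHomSub_span (hM : g.IsModGrading gM) {s : Set M}
    (hs : ∀ x ∈ s, ∃ i, gM.IsHom i x) : gM.IsHomSub (Submodule.span S s) := by
  intro x hx
  induction hx using Submodule.span_induction with
  | mem x hx =>
    intro i
    obtain ⟨j, hj⟩ := hs x hx
    by_cases h : j = i
    · rw [← h, hj.dec_self]
      exact Submodule.subset_span hx
    · rw [hj.dec_of_ne h]
      exact Submodule.zero_mem _
  | zero => intro i; simp
  | add x y _ _ hx hy =>
    intro i
    rw [map_add, Finsupp.add_apply]
    exact Submodule.add_mem _ (hx i) (hy i)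
  | smul r x _ hx =>
    induction r using g.toZGrading.induction with
    | hom j r hr =>
      intro i
      rw [hM.dec_smul' hr]
      exact Submodule.smul_mem _ _ (hx _)
    | add r r' h h' =>
      intro i
      rw [add_smul, map_add, Finsupp.add_apply]
      exact Submodule.add_mem _ (h i) (h' i)

/-- A finite set of homogeneous elements that generates the components of a finite set. -/
theorem ZGrading.exists_finset_isHom (gM : ZGrading M) (s : Finset M) :
    ∃ t : Finset M, (∀ x ∈ t, ∃ i, gM.IsHom i x) ∧
      (s : Set M) ⊆ Submodule.span S (t : Set M) := by
  classical
  refine ⟨s.biUnion fun x => (gM.dec x).support.image (gM.dec x), ?_, ?_⟩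
  · intro y hy
    obtain ⟨x, _, hx⟩ := Finset.mem_biUnion.1 hy
    obtain ⟨i, _, rfl⟩ := Finset.mem_image.1 hx
    exact ⟨i, gM.isHom_dec x i⟩
  · intro x hx
    rw [SetLike.mem_coe, ← gM.sum_dec x]
    refine Submodule.sum_mem _ fun i hi => Submodule.subset_span ?_
    exact Finset.mem_biUnion.2 ⟨x, hx, Finset.mem_image_of_mem _ hi⟩

theorem RingZGrading.IsModGrading.exists_fg_isHomSub (hM : g.IsModGrading gM)
    {A : Submodule S M} (hA : A.FG) : ∃ B : Submodule S M, B.FG ∧ gM.IsHomSub B ∧ A ≤ B := by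
  obtain ⟨s, rfl⟩ := hA
  obtain ⟨t, ht, hst⟩ := gM.exists_finset_isHom (S := S) s
  exact ⟨_, ⟨t, rfl⟩, hM.isHomSub_span ht, Submodule.span_le.2 hst⟩

/-- An endomorphism whose range is contained in a finitely generated module over an artinian ring
has a power with complementary kernel and range. -/
theorem exists_isCompl_ker_range_pow [IsArtinianRing S] (e : Module.End S M) {A : Submodule S M}
    (hA : A.FG) (he : LinearMap.range e ≤ A) :
    ∃ n, LinearMap.range (e ^ (n + 1)) ≤ A ∧
      IsCompl (LinearMap.range (e ^ (n + 1))) (LinearMap.ker (e ^ (n + 1))) := by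
  have : Module.Finite S A := Module.Finite.iff_fg.2 hA
  have hle : ∀ n, LinearMap.range (e ^ (n + 1)) ≤ A := by
    intro n
    rw [pow_succ']
    exact (LinearMap.range_comp_le_range _ _).trans he
  -- `M` itself need not be artinian, so the descending ranges are viewed inside `A`. The exponent
  -- starts at `1` because the range of `e ^ 0` is all of `M`.
  let F : ℕ →o (Submodule S A)ᵒᵈ :=
    { toFun := fun n => OrderDual.toDual ((LinearMap.range (e ^ (n + 1))).comap A.subtype)
      monotone' := by
        refine monotone_nat_of_le_succ fun n => ?_
        refine OrderDual.toDual_le_toDual.2 (Submodule.comap_mono ?_)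
        rw [pow_succ e (n + 1)]
        exact LinearMap.range_comp_le_range _ _ }
  obtain ⟨n, hn⟩ := IsArtinian.monotone_stabilizes F
  have hstab : ∀ m, n ≤ m → LinearMap.range (e ^ (m + 1)) = LinearMap.range (e ^ (n + 1)) := by
    intro m hm
    have h := congrArg (Submodule.map A.subtype) (OrderDual.toDual_inj.1 (hn m hm))
    rw [Submodule.map_comap_subtype, Submodule.map_comap_subtype, inf_eq_right.2 (hle _),
      inf_eq_right.2 (hle _)] at h
    exact h.symm
  refine ⟨n, hle n, ?_⟩
  set f := e ^ (n + 1) with hf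
  have hff : LinearMap.range (f * f) = LinearMap.range f := by
    rw [hf, ← pow_add, ← hstab (n + (n + 1)) (by omega)]
    congr 2
    ring
  constructor
  · have hmaps : ∀ x ∈ LinearMap.range f, f x ∈ LinearMap.range f := fun x _ => ⟨x, rfl⟩
    have : IsNoetherian S (LinearMap.range f) := isNoetherian_of_le (hle n)
    have hsurj : Function.Surjective (f.restrict hmaps) := by
      rintro ⟨y, hy⟩
      rw [← hff] at hy
      obtain ⟨x, rfl⟩ := hy
      exact ⟨⟨f x, x, rfl⟩, rfl⟩
    have hinj := IsNoetherian.injective_of_surjective_endomorphism _ hsurj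
    rw [Submodule.disjoint_def]
    intro x hx hfx
    have : f.restrict hmaps ⟨x, hx⟩ = f.restrict hmaps 0 := by
      ext
      simpa using hfx
    exact congrArg Subtype.val (hinj this)
  · rw [codisjoint_iff, eq_top_iff]
    intro x _
    have : f x ∈ LinearMap.range (f * f) := hff ▸ LinearMap.mem_range_self f x
    obtain ⟨y, hy⟩ := this
    refine Submodule.mem_sup.2 ⟨f y, ⟨y, rfl⟩, x - f y, ?_, by abel⟩
    rw [LinearMap.mem_ker, map_sub, sub_eq_zero, ← hy]
    rfl

theorem ZGrading.IsHomMap.pow {e : Module.End S M} (he : gM.IsHomMap gM 0 e.toAddMonoidHom)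
    (n : ℕ) : gM.IsHomMap gM 0 (e ^ n).toAddMonoidHom := by
  induction n with
  | zero => exact ZGrading.isHomMap_id
  | succ n ih =>
    rw [pow_succ]
    have := ih.comp he
    rwa [add_zero] at this

/-- A nonzero element fixed by an endomorphism with small range provides a finitely generated
homogeneous direct summand. -/
theorem exists_isCompl_isHomSub [IsArtinianRing S] (hM : g.IsModGrading gM) {i : ℤ} {x : M}
    (hx : gM.IsHom i x) (hx0 : x ≠ 0) (φ : Module.End S M) {A : Submodule S M} (hA : A.FG)
    (hφ : LinearMap.range φ ≤ A) (hφx : φ x = x) :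
    ∃ B C : Submodule S M, gM.IsHomSub B ∧ gM.IsHomSub C ∧ IsCompl B C ∧ B.FG ∧ B ≠ ⊥ := by
  obtain ⟨A', hA', hA'h, hAA'⟩ := hM.exists_fg_isHomSub hA
  -- The degree-zero part still fixes the homogeneous `x`, and its range stays in the homogeneous
  -- enlargement `A'`. Fitting's lemma then gives graded summands.
  let e : Module.End S M := RingZGrading.degPart hM hM 0 φ
  have he : gM.IsHomMap gM 0 e.toAddMonoidHom := RingZGrading.isHomMap_degPart hM hM 0 φ
  have hex : e x = x := by
    rw [RingZGrading.degPart_of_isHom hM hM φ hx, hφx, add_zero, hx.dec_self]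
  have hrange : LinearMap.range e ≤ A' := by
    rintro _ ⟨y, rfl⟩
    induction y using gM.induction with
    | hom j y hy =>
      rw [RingZGrading.degPart_of_isHom hM hM φ hy]
      exact hA'h _ (hAA' (hφ ⟨y, rfl⟩)) _
    | add y z hy hz => rw [map_add]; exact Submodule.add_mem _ hy hz
  obtain ⟨n, hn, hcompl⟩ := exists_isCompl_ker_range_pow e hA' hrange
  refine ⟨_, _, (he.pow _).isHomSub_range, (he.pow _).isHomSub_ker, hcompl, ?_, ?_⟩
  · have : Module.Finite S A' := Module.Finite.iff_fg.2 hA'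
    have : IsNoetherian S (LinearMap.range (e ^ (n + 1))) := isNoetherian_of_le hn
    exact Module.Finite.iff_fg.1 inferInstance
  · have hpow : ∀ k, (e ^ k) x = x := by
      intro k
      induction k with
      | zero => rfl
      | succ k ih =>
        rw [pow_succ]
        change (e ^ k) (e x) = x
        rw [hex, ih]
    intro hbot
    have : x ∈ LinearMap.range (e ^ (n + 1)) := ⟨x, hpow _⟩
    rw [hbot] at this
    exact hx0 ((Submodule.mem_bot S).1 this)

theorem isCompl_map_subtype_sup {A B : Submodule S M} (hAB : IsCompl A B) {C D : Submodule S A}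
    (hCD : IsCompl C D) : IsCompl (C.map A.subtype) (D.map A.subtype ⊔ B) := by
  constructor
  · rw [Submodule.disjoint_def]
    rintro _ ⟨c, hc, rfl⟩ hx
    obtain ⟨_, ⟨d, hd, rfl⟩, b, hb, hdb⟩ := Submodule.mem_sup.1 hx
    have h1 : A.subtype (c - d) ∈ B := by
      have : A.subtype (c - d) = b := by
        rw [map_sub, ← hdb]
        abel
      rwa [this]
    have h2 := Submodule.disjoint_def.1 hAB.disjoint _ (c - d).2 h1
    have h3 : c = d := sub_eq_zero.1 (Subtype.ext h2)
    have h4 := Submodule.disjoint_def.1 hCD.disjoint c hc (h3 ▸ hd)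
    rw [h4, map_zero]
  · rw [codisjoint_iff, ← sup_assoc, ← Submodule.map_sup, hCD.sup_eq_top, Submodule.map_top,
      Submodule.range_subtype, hAB.sup_eq_top]

/-- Among the nonzero finitely generated graded summands, one of least length is
graded-indecomposable, since a graded summand of a graded summand is again one. -/
theorem exists_indecomposable_isHomSub [IsArtinianRing S] {B C : Submodule S M}
    (hB : gM.IsHomSub B) (hC : gM.IsHomSub C) (hBC : IsCompl B C) (hfg : B.FG) (h0 : B ≠ ⊥) :
    ∃ (A D : Submodule S M) (hA : gM.IsHomSub A), gM.IsHomSub D ∧ IsCompl A D ∧ A.FG ∧ A ≠ ⊥ ∧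
      hA.subGrading.IsIndecomposable S := by
  let P : Set (Submodule S M) := {A | gM.IsHomSub A ∧ A.FG ∧ A ≠ ⊥ ∧
    ∃ D, gM.IsHomSub D ∧ IsCompl A D}
  obtain ⟨A, ⟨hA, hAfg, hA0, D, hD, hAD⟩, hmin⟩ := WellFounded.has_min
    (InvImage.wf (fun A : Submodule S M => Module.length S A) wellFounded_lt) P
    ⟨B, hB, hfg, h0, C, hC, hBC⟩
  refine ⟨A, D, hA, hD, hAD, hAfg, hA0, ?_⟩
  intro E E' hE hE' hEE'
  by_contra! hne
  have : Module.Finite S A := Module.Finite.iff_fg.2 hAfg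
  have hsub : hA.subGrading.IsHomMap gM 0 A.subtype.toAddMonoidHom := by
    intro i x hx
    rw [add_zero]
    exact hA.subGrading_isHom_iff.1 hx
  refine hmin (E.map A.subtype) ⟨hsub.isHomSub_map hE, ?_, ?_, E'.map A.subtype ⊔ D,
    (hsub.isHomSub_map hE').sup hD, isCompl_map_subtype_sup hAD hEE'⟩ ?_
  · exact (IsNoetherian.noetherian E).map _
  · intro h
    refine hne.1 (Submodule.map_injective_of_injective A.injective_subtype ?_)
    rw [h, Submodule.map_bot]
  · change Module.length S (E.map A.subtype) < Module.length S A
    rw [← (Submodule.equivMapOfInjective A.subtype A.injective_subtype E).length_eq]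
    exact Submodule.length_lt hne.2

/-- A module is gradable if it has a grading compatible with that of the ring. -/
def RingZGrading.Gradable (g : RingZGrading S) (N : Type*) [AddCommGroup N] [Module S N] : Prop :=
  ∃ gN : ZGrading N, g.IsModGrading gN

theorem RingZGrading.Gradable.of_equiv (h : g.Gradable M) (e : M ≃ₗ[S] L) : g.Gradable L := by
  obtain ⟨gM, hM⟩ := h
  have hπ : Function.Surjective e.toLinearMap.toAddMonoidHom := e.surjective
  refine ⟨gM.ofSurjective e.toLinearMap.toAddMonoidHom hπ ?_, hM.ofSurjective e.toLinearMap _ _⟩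
  intro x hx i
  have : x = 0 := e.injective (by rw [map_zero]; exact hx)
  simp [this]

theorem RingZGrading.Gradable.prod (h : g.Gradable M) (h' : g.Gradable L) :
    g.Gradable (M × L) := by
  obtain ⟨gM, hM⟩ := h
  obtain ⟨gL, hL⟩ := h'
  exact ⟨_, hM.prod hL⟩

theorem RingZGrading.gradable_of_subsingleton [Subsingleton M] : g.Gradable M :=
  ⟨{ dec := 0
     dec_dec := fun x i => by simp
     sum_dec := fun x => Subsingleton.elim _ _ }, fun i j r m _ _ => by
      simp [ZGrading.IsHom, Subsingleton.elim (r • m) 0]⟩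

/-- Every element is fixed by an endomorphism with range in a finitely generated submodule. -/
def LocallyFixed (S : Type*) [Ring S] (M : Type*) [AddCommGroup M] [Module S M] : Prop :=
  ∀ x : M, ∃ (φ : Module.End S M) (A : Submodule S M), A.FG ∧ LinearMap.range φ ≤ A ∧ φ x = x

theorem LocallyFixed.of_retract (h : LocallyFixed S M) (a : L →ₗ[S] M) (b : M →ₗ[S] L)
    (hba : ∀ x, b (a x) = x) : LocallyFixed S L := by
  intro x
  obtain ⟨φ, A, hA, hφ, hφx⟩ := h (a x)
  refine ⟨b ∘ₗ φ ∘ₗ a, A.map b, hA.map b, ?_, ?_⟩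
  · rintro _ ⟨y, rfl⟩
    exact ⟨_, hφ ⟨a y, rfl⟩, rfl⟩
  · simp [hφx, hba]

theorem LocallyFixed.laurent_retract (h : LocallyFixed S (Laurent g M)) (a : L →ₗ[S] M)
    (b : M →ₗ[S] L) (hba : ∀ x, b (a x) = x) : LocallyFixed S (Laurent g L) := by
  refine h.of_retract (Laurent.map g a) (Laurent.map g b) fun x => ?_
  induction x using Laurent.induction with
  | hs i n => simp [hba]
  | ha x y hx hy => rw [map_add, map_add, hx, hy]

/-- A nonzero `n t ^ 0` yields a nonzero graded-indecomposable finitely generated summand of the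
Laurent module, to which `Laurent.exists_retraction` applies. -/
theorem exists_gradable_retract [IsArtinianRing S] [Nontrivial N]
    (h : LocallyFixed S (Laurent g N)) :
    ∃ (A : Submodule S (Laurent g N)), A ≠ ⊥ ∧ g.Gradable A ∧
      ∃ (a : A →ₗ[S] N) (b : N →ₗ[S] A), ∀ y, b (a y) = y := by
  have hX : g.IsModGrading (Laurent.grading g N) := Laurent.isModGrading
  obtain ⟨n, hn⟩ := exists_ne (0 : N)
  obtain ⟨φ, A₀, hA₀, hφ, hφx⟩ := h (Laurent.single g N 0 n)
  have hx0 : Laurent.single g N 0 n ≠ 0 := by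
    intro h0
    apply hn
    rw [← Laurent.coeff_single_self g 0 n, h0, map_zero]
  obtain ⟨B, C, hB, hC, hBC, hBfg, hB0⟩ := exists_isCompl_isHomSub hX (Laurent.isHom_single 0 n)
    hx0 φ hA₀ hφ hφx
  obtain ⟨A, D, hA, hD, hAD, hAfg, hA0, hind⟩ :=
    exists_indecomposable_isHomSub hB hC hBC hBfg hB0
  have : Module.Finite S A := Module.Finite.iff_fg.2 hAfg
  have : Nontrivial A := (Submodule.nontrivial_iff_ne_bot).2 hA0
  have hAmod := hA.isModGrading_subGrading hX
  obtain ⟨F, hF⟩ := exists_support hAmod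
  refine ⟨A, hA0, ⟨_, hAmod⟩, ?_⟩
  have hsub : hA.subGrading.IsHomMap (Laurent.grading g N) 0 A.subtype.toAddMonoidHom := by
    intro i x hx
    rw [add_zero]
    exact hA.subGrading_isHom_iff.1 hx
  refine Laurent.exists_retraction hind hF A.subtype hsub (A.projectionOnto D hAD) ?_
    (fun y => Submodule.projectionOnto_apply_left hAD y)
  intro i x hx
  rw [add_zero, hA.subGrading_isHom_iff]
  obtain ⟨a, ha, d, hd, rfl⟩ := Submodule.mem_sup.1
    (show x ∈ A ⊔ D from hAD.sup_eq_top ▸ Submodule.mem_top)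
  -- Both summands are homogeneous, so the projection commutes with taking components and has degree
  -- zero.
  have key : ∀ a ∈ A, ∀ d ∈ D, (A.projectionOnto D hAD (a + d) : Laurent g N) = a := by
    intro a ha d hd
    rw [map_add, Submodule.projectionOnto_apply_of_mem_right hAD hd, add_zero]
    exact congrArg Subtype.val (Submodule.projectionOnto_apply_left hAD ⟨a, ha⟩)
  have h1 : (A.projectionOnto D hAD (a + d) : Laurent g N) = (Laurent.grading g N).dec a i := by
    rw [← key _ (hA a ha i) _ (hD d hd i), ← Finsupp.add_apply, ← map_add, hx.dec_self]
  change (Laurent.grading g N).IsHom i (A.projectionOnto D hAD (a + d) : Laurent g N)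
  rw [h1]
  exact ZGrading.isHom_dec _ _ _

end Summands

/-! ### Gradability from local fixedness -/

section Gradability

variable {S : Type*} [Ring S] {g : RingZGrading S}

/-- Induction on length: `N` is the sum of a nonzero gradable retract and the kernel of the
retraction, and local fixedness passes to the Laurent module of that kernel because it is a retract.
-/
theorem gradable_of_locallyFixed_of_length [IsArtinianRing S] (n : ℕ∞) :
    ∀ (N : Type w) [AddCommGroup N] [Module S N] [IsArtinian S N] [IsNoetherian S N],
    LocallyFixed S (Laurent g N) → Module.length S N = n → g.Gradable N := by
  induction n using WellFoundedLT.induction with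
  | ind n ih =>
  intro N _ _ _ _ hN hn
  rcases subsingleton_or_nontrivial N with hs | hs
  · exact RingZGrading.gradable_of_subsingleton
  obtain ⟨A, hA0, hA, a, b, hba⟩ := exists_gradable_retract hN
  let r : N →ₗ[S] LinearMap.ker b := (LinearMap.id - a ∘ₗ b).codRestrict _ fun x => by
    simp [hba]
  have hr : ∀ x : LinearMap.ker b, r (Submodule.subtype _ x) = x := fun x => by
    ext
    simp [r, LinearMap.mem_ker.1 x.2]
  have hker : LinearMap.ker b ≠ ⊤ := by
    intro h
    apply hA0
    rw [eq_bot_iff]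
    intro y hy
    have h1 : b (a ⟨y, hy⟩) = 0 := by
      rw [LinearMap.ker_eq_top.1 h]
      rfl
    rw [hba] at h1
    exact congrArg Subtype.val h1
  have hK : g.Gradable (LinearMap.ker b) :=
    ih _ (hn ▸ Submodule.length_lt hker) _ (hN.laurent_retract _ r hr) rfl
  refine (hA.prod hK).of_equiv (LinearEquiv.ofLinearMap (a.coprod (Submodule.subtype _))
    (b.prod r) ?_ ?_)
  · ext x
    simp [r]
  · ext x
    · simp [hba]
    · simp [r, hba]
    · simp
    · simp [r, LinearMap.mem_ker.1 x.2]

/-- A finitely generated module `N` over a graded left artinian ring is gradable if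
`N ⊗ ℤ[t, t⁻¹]` is locally fixed. -/
theorem gradable_of_locallyFixed [IsArtinianRing S] {N : Type*} [AddCommGroup N] [Module S N]
    [Module.Finite S N] (hN : LocallyFixed S (Laurent g N)) : g.Gradable N :=
  gradable_of_locallyFixed_of_length _ N hN rfl

theorem LocallyFixed.finsupp {ι M : Type*} [AddCommGroup M] [Module S M] [Module.Finite S M] :
    LocallyFixed S (ι →₀ M) := by
  intro x
  refine ⟨∑ i ∈ x.support, Finsupp.lsingle i ∘ₗ Finsupp.lapply i,
    ⨆ i ∈ x.support, LinearMap.range (Finsupp.lsingle i : M →ₗ[S] ι →₀ M), ?_, ?_, ?_⟩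
  · refine Submodule.fg_biSup _ _ fun i _ => ?_
    rw [LinearMap.range_eq_map]
    exact Module.Finite.fg_top.map _
  · rintro _ ⟨y, rfl⟩
    rw [LinearMap.sum_apply]
    exact Submodule.sum_mem _ fun i hi =>
      Submodule.mem_iSup_of_mem i (Submodule.mem_iSup_of_mem hi ⟨y i, rfl⟩)
  · rw [LinearMap.sum_apply]
    exact x.sum_single

/-- For a graded `M` the twisted module untwists to a direct sum of copies of `M`: `n t ^ i` with
`n` of degree `k` goes to `n` in position `i - k`, which scalars do not change. -/
theorem RingZGrading.IsModGrading.locallyFixed {M : Type*} [AddCommGroup M] [Module S M]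
    [Module.Finite S M] {gM : ZGrading M} (hM : g.IsModGrading gM) :
    LocallyFixed S (Laurent g M) := by
  let α : Laurent g M →ₗ[S] (ℤ →₀ M) := g.linearMapOfHom
    (Laurent.lift g fun i => (Finsupp.mapDomain.addMonoidHom (i - ·)).comp gM.dec)
    fun j r hr x => by
      induction x using Laurent.induction with
      | hs i n =>
        rw [Laurent.smul_single hr, Laurent.lift_single, Laurent.lift_single]
        induction n using gM.induction with
        | hom k n hn =>
          simp only [AddMonoidHom.comp_apply, Finsupp.mapDomain.addMonoidHom_apply]
          rw [hM hr hn, hn, Finsupp.mapDomain_single, Finsupp.mapDomain_single,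
            Finsupp.smul_single, add_comm j k, add_sub_add_right_eq_sub]
        | add n n' h h' => rw [smul_add, map_add, h, h', map_add, smul_add]
      | ha x y hx hy => rw [smul_add, map_add, hx, hy, map_add, smul_add]
  let β : (ℤ →₀ M) →ₗ[S] Laurent g M :=
    Finsupp.lsum ℕ fun i => Laurent.shift g M i ∘ₗ Laurent.coact hM
  refine LocallyFixed.finsupp.of_retract α β fun x => ?_
  induction x using Laurent.induction with
  | hs i n =>
    induction n using gM.induction with
    | hom k n hn =>
      have : α (Laurent.single g M i n) = Finsupp.single (i - k) n := by
        simp only [α, RingZGrading.linearMapOfHom_apply, Laurent.lift_single,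
          AddMonoidHom.comp_apply, Finsupp.mapDomain.addMonoidHom_apply]
        rw [hn, Finsupp.mapDomain_single]
      rw [this]
      simp [β, Laurent.coact_of_isHom hM hn]
    | add n n' h h' => rw [map_add, map_add, map_add, h, h']
  | ha x y hx hy => rw [map_add, map_add, hx, hy]

/-- Over a graded left artinian ring, direct summands of finitely generated gradable modules are
gradable. -/
theorem RingZGrading.Gradable.of_retract [IsArtinianRing S] {M L : Type*} [AddCommGroup M]
    [Module S M] [Module.Finite S M] [AddCommGroup L] [Module S L] (h : g.Gradable M)
    (a : L →ₗ[S] M) (b : M →ₗ[S] L) (hba : ∀ x, b (a x) = x) : g.Gradable L := by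
  obtain ⟨gM, hM⟩ := h
  have : Module.Finite S L := Module.Finite.of_surjective b fun x => ⟨a x, hba x⟩
  exact gradable_of_locallyFixed (hM.locallyFixed.laurent_retract a b hba)

theorem IsPureProjective.locallyFixed {S : Type u} [Ring S] {M : Type u} [AddCommGroup M]
    [Module S M] (h : IsPureProjective S M) : LocallyFixed S M := by
  intro x
  obtain ⟨P, _, _, α, β, hP, hβ⟩ := h.exists_factor {x} (Set.finite_singleton x)
  refine ⟨β ∘ₗ α, LinearMap.range β, ?_, LinearMap.range_comp_le_range _ _, hβ x rfl⟩
  rw [LinearMap.range_eq_map]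
  exact Module.Finite.fg_top.map _

/-- Finitely generated modules over a graded left pure-semisimple ring are gradable. -/
theorem IsLeftPureSemisimple.gradable {S : Type u} [Ring S] (h : IsLeftPureSemisimple S)
    (g : RingZGrading S) (N : Type v) [AddCommGroup N] [Module S N] [Module.Finite S N] :
    g.Gradable N := by
  have := h.isArtinianRing
  obtain ⟨n, f, hf⟩ := Module.Finite.exists_fin' S N
  -- Pure-semisimplicity speaks of modules in the universe of `S`, so `N` is replaced by an
  -- isomorphic quotient of a free module.
  have : g.Gradable ((Fin n → S) ⧸ LinearMap.ker f) :=
    gradable_of_locallyFixed (h (Laurent g ((Fin n → S) ⧸ LinearMap.ker f))).locallyFixed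
  exact this.of_equiv (f.quotKerEquivOfSurjective hf)

end Gradability

/-! ### Linear maps as modules over a triangular matrix ring -/

section Triangular

/-- The ring of lower triangular `2 × 2` matrices over `A`; the entry above the diagonal is
omitted. -/
def Tri (A : Type*) : Type _ := A × A × A

namespace Tri

variable {A : Type*} [Ring A]

/-- The matrix with rows `(a, 0)` and `(b, c)`. -/
def mk (a b c : A) : Tri A := (a, b, c)

instance : AddCommGroup (Tri A) := inferInstanceAs (AddCommGroup (A × A × A))

instance : Module A (Tri A) := inferInstanceAs (Module A (A × A × A))

instance : Ring (Tri A) :=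
  { (inferInstance : AddCommGroup (Tri A)) with
    mul := fun s t => mk (s.1 * t.1) (s.2.1 * t.1 + s.2.2 * t.2.1) (s.2.2 * t.2.2)
    one := mk 1 0 1
    left_distrib := fun s t r => by
      refine Prod.ext (mul_add _ _ _) (Prod.ext ?_ (mul_add _ _ _))
      change s.2.1 * (t.1 + r.1) + s.2.2 * (t.2.1 + r.2.1) =
        s.2.1 * t.1 + s.2.2 * t.2.1 + (s.2.1 * r.1 + s.2.2 * r.2.1)
      noncomm_ring
    right_distrib := fun s t r => by
      refine Prod.ext (add_mul _ _ _) (Prod.ext ?_ (add_mul _ _ _))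
      change (s.2.1 + t.2.1) * r.1 + (s.2.2 + t.2.2) * r.2.1 =
        s.2.1 * r.1 + s.2.2 * r.2.1 + (t.2.1 * r.1 + t.2.2 * r.2.1)
      noncomm_ring
    zero_mul := fun s => by
      refine Prod.ext (zero_mul _) (Prod.ext ?_ (zero_mul _))
      change 0 * s.1 + 0 * s.2.1 = 0
      noncomm_ring
    mul_zero := fun s => by
      refine Prod.ext (mul_zero _) (Prod.ext ?_ (mul_zero _))
      change s.2.1 * 0 + s.2.2 * 0 = 0
      noncomm_ring
    mul_assoc := fun s t r => by
      refine Prod.ext (mul_assoc _ _ _) (Prod.ext ?_ (mul_assoc _ _ _))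
      change (s.2.1 * t.1 + s.2.2 * t.2.1) * r.1 + s.2.2 * t.2.2 * r.2.1 =
        s.2.1 * (t.1 * r.1) + s.2.2 * (t.2.1 * r.1 + t.2.2 * r.2.1)
      noncomm_ring
    one_mul := fun s => by
      refine Prod.ext (one_mul _) (Prod.ext ?_ (one_mul _))
      change 0 * s.1 + 1 * s.2.1 = s.2.1
      noncomm_ring
    mul_one := fun s => by
      refine Prod.ext (mul_one _) (Prod.ext ?_ (mul_one _))
      change s.2.1 * 1 + s.2.2 * 0 = s.2.1
      noncomm_ring }

instance : IsScalarTower A (Tri A) (Tri A) where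
  smul_assoc r s t := by
    refine Prod.ext (mul_assoc _ _ _) (Prod.ext ?_ (mul_assoc _ _ _))
    change r * s.2.1 * t.1 + r * s.2.2 * t.2.1 = r * (s.2.1 * t.1 + s.2.2 * t.2.1)
    noncomm_ring

/-- This makes the theorem on summands of gradable modules available for arrows. -/
instance [IsArtinianRing A] : IsArtinianRing (Tri A) :=
  isArtinian_of_tower A (inferInstanceAs (IsArtinian A (A × A × A)))

/-- The entrywise grading of the triangular matrix ring. -/
noncomputable def grading (g : RingZGrading A) : RingZGrading (Tri A) where
  toZGrading := g.toZGrading.prod (g.toZGrading.prod g.toZGrading)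
  one_isHom := by
    refine (ZGrading.prod_isHom_iff _ _ _ _).2 ⟨g.one_isHom, ?_⟩
    exact (ZGrading.prod_isHom_iff _ _ _ _).2 ⟨g.isHom_zero 0, g.one_isHom⟩
  mul_isHom := by
    intro i j x y hx hy
    obtain ⟨hx1, hx2⟩ := (ZGrading.prod_isHom_iff _ _ _ _).1 hx
    obtain ⟨hx2, hx3⟩ := (ZGrading.prod_isHom_iff _ _ _ _).1 hx2
    obtain ⟨hy1, hy2⟩ := (ZGrading.prod_isHom_iff _ _ _ _).1 hy
    obtain ⟨hy2, hy3⟩ := (ZGrading.prod_isHom_iff _ _ _ _).1 hy2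
    refine (ZGrading.prod_isHom_iff _ _ _ _).2 ⟨g.mul_isHom hx1 hy1, ?_⟩
    exact (ZGrading.prod_isHom_iff _ _ _ _).2
      ⟨(g.mul_isHom hx2 hy1).add (g.mul_isHom hx3 hy2), g.mul_isHom hx3 hy3⟩

theorem grading_isHom_iff {g : RingZGrading A} {i : ℤ} {s : Tri A} :
    (grading g).IsHom i s ↔ g.IsHom i s.1 ∧ g.IsHom i s.2.1 ∧ g.IsHom i s.2.2 := by
  refine (ZGrading.prod_isHom_iff _ _ _ _).trans (and_congr_right' ?_)
  exact ZGrading.prod_isHom_iff _ _ _ _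

end Tri

variable {A : Type*} [Ring A] {V W V' W' : Type*} [AddCommGroup V] [Module A V] [AddCommGroup W]
  [Module A W] [AddCommGroup V'] [Module A V'] [AddCommGroup W'] [Module A W']

/-- The module over the triangular matrix ring that corresponds to a linear map. -/
def Arrow (_d : V →ₗ[A] W) : Type _ := V × W

namespace Arrow

variable (d : V →ₗ[A] W)

instance : AddCommGroup (Arrow d) := inferInstanceAs (AddCommGroup (V × W))

instance : Module A (Arrow d) := inferInstanceAs (Module A (V × W))

variable {d} in
/-- A pair of elements of the source and the target. -/
def mk (x : V) (y : W) : Arrow d := (x, y)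

instance : Module (Tri A) (Arrow d) where
  smul s x := mk (s.1 • x.1) (s.2.1 • d x.1 + s.2.2 • x.2)
  one_smul x := by
    refine Prod.ext (one_smul A _) ?_
    change (0 : A) • d x.1 + (1 : A) • x.2 = x.2
    simp
  mul_smul s t x := by
    refine Prod.ext (mul_smul _ _ _) ?_
    change (s.2.1 * t.1 + s.2.2 * t.2.1) • d x.1 + (s.2.2 * t.2.2) • x.2 =
      s.2.1 • d (t.1 • x.1) + s.2.2 • (t.2.1 • d x.1 + t.2.2 • x.2)
    simp only [add_smul, mul_smul, smul_add, map_smul]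
    abel
  smul_zero s := by
    refine Prod.ext (smul_zero _) ?_
    change s.2.1 • d 0 + s.2.2 • (0 : W) = 0
    simp
  smul_add s x y := by
    refine Prod.ext (smul_add _ _ _) ?_
    change s.2.1 • d (x.1 + y.1) + s.2.2 • (x.2 + y.2) =
      s.2.1 • d x.1 + s.2.2 • x.2 + (s.2.1 • d y.1 + s.2.2 • y.2)
    simp only [smul_add, map_add]
    abel
  add_smul s t x := by
    refine Prod.ext (add_smul _ _ _) ?_
    change (s.2.1 + t.2.1) • d x.1 + (s.2.2 + t.2.2) • x.2 =
      s.2.1 • d x.1 + s.2.2 • x.2 + (t.2.1 • d x.1 + t.2.2 • x.2)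
    simp only [add_smul]
    abel
  zero_smul x := by
    refine Prod.ext (zero_smul A _) ?_
    change (0 : A) • d x.1 + (0 : A) • x.2 = 0
    simp

instance : IsScalarTower A (Tri A) (Arrow d) where
  smul_assoc r s x := by
    refine Prod.ext (mul_smul _ _ _) ?_
    change (r * s.2.1) • d x.1 + (r * s.2.2) • x.2 = r • (s.2.1 • d x.1 + s.2.2 • x.2)
    simp only [mul_smul, smul_add]

instance [Module.Finite A V] [Module.Finite A W] : Module.Finite (Tri A) (Arrow d) :=
  have : Module.Finite A (Arrow d) := inferInstanceAs (Module.Finite A (V × W))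
  Module.Finite.of_restrictScalars_finite A (Tri A) (Arrow d)

/-- The map of arrows that is given by a commutative square. -/
def map {d : V →ₗ[A] W} {d' : V' →ₗ[A] W'} (a : V →ₗ[A] V') (b : W →ₗ[A] W')
    (h : ∀ x, d' (a x) = b (d x)) : Arrow d →ₗ[Tri A] Arrow d' where
  toFun x := mk (a x.1) (b x.2)
  map_add' x y := Prod.ext (map_add a _ _) (map_add b _ _)
  map_smul' s x := by
    refine Prod.ext (map_smul a _ _) ?_
    change b (s.2.1 • d x.1 + s.2.2 • x.2) = s.2.1 • d' (a x.1) + s.2.2 • b x.2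
    rw [h, map_add, map_smul, map_smul]

theorem gradable {g : RingZGrading A} {gV : ZGrading V} {gW : ZGrading W}
    (hV : g.IsModGrading gV) (hW : g.IsModGrading gW) {d : V →ₗ[A] W}
    (hd : gV.IsHomMap gW 0 d.toAddMonoidHom) : (Tri.grading g).Gradable (Arrow d) := by
  refine ⟨(gV.prod gW : ZGrading (V × W)), ?_⟩
  intro i j s x hs hx
  obtain ⟨hs1, hs2, hs3⟩ := Tri.grading_isHom_iff.1 hs
  obtain ⟨hx1, hx2⟩ := (ZGrading.prod_isHom_iff _ _ _ _).1 hx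
  refine (ZGrading.prod_isHom_iff _ _ _ _).2 ⟨hV hs1 hx1, ?_⟩
  have := hd j x.1 hx1
  rw [add_zero] at this
  exact (hW hs2 this).add (hW hs3 hx2)

/-- A grading of an arrow is given by gradings of the source and the target for which the map
is homogeneous. -/
theorem exists_grading {g : RingZGrading A} {d : V →ₗ[A] W}
    (h : (Tri.grading g).Gradable (Arrow d)) :
    ∃ (gV : ZGrading V) (gW : ZGrading W), g.IsModGrading gV ∧ g.IsModGrading gW ∧
      gV.IsHomMap gW 0 d.toAddMonoidHom := by
  obtain ⟨gD, hD⟩ := h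
  let ι : V →+ Arrow d := AddMonoidHom.inl V W
  let κ : W →+ Arrow d := AddMonoidHom.inr V W
  have hι : Function.Injective ι := fun x y h => congrArg Prod.fst h
  have hκ : Function.Injective κ := fun x y h => congrArg Prod.snd h
  have hιs : ∀ (r : A) x, ι (r • x) = Tri.mk r 0 0 • ι x := fun r x => by
    refine Prod.ext rfl ?_
    change 0 = (0 : A) • d x + (0 : A) • (0 : W)
    simp
  have hκs : ∀ (r : A) y, κ (r • y) = Tri.mk 0 0 r • κ y := fun r y => by
    refine Prod.ext ?_ ?_
    · change 0 = (0 : A) • (0 : V)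
      simp
    · change r • y = (0 : A) • d 0 + r • y
      simp
  have hd : ∀ x, κ (d x) = Tri.mk (0 : A) 1 0 • ι x := fun x => by
    refine Prod.ext ?_ ?_
    · change 0 = (0 : A) • x
      simp
    · change d x = (1 : A) • d x + (0 : A) • (0 : W)
      simp
  have h0 := g.isHom_zero
  have hιr : ∀ x i, ∃ y, ι y = gD.dec (ι x) i := by
    intro x i
    -- The diagonal idempotents have degree zero, so components of elements of the source or of the
    -- target stay there.
    have h1 : (Tri.grading g).IsHom 0 (Tri.mk 1 0 0) :=
      Tri.grading_isHom_iff.2 ⟨g.one_isHom, h0 0, h0 0⟩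
    have h2 := hD.dec_smul h1 (ι x) i
    rw [← hιs, one_smul, zero_add] at h2
    refine ⟨(gD.dec (ι x) i).1, Prod.ext rfl ?_⟩
    have h3 : (gD.dec (ι x) i).2 = (0 : A) • d (gD.dec (ι x) i).1 + (0 : A) • (gD.dec (ι x) i).2 :=
      congrArg Prod.snd h2
    rw [zero_smul, zero_smul, add_zero] at h3
    exact h3.symm
  have hκr : ∀ x i, ∃ y, κ y = gD.dec (κ x) i := by
    intro x i
    have h1 : (Tri.grading g).IsHom 0 (Tri.mk 0 0 1) :=
      Tri.grading_isHom_iff.2 ⟨h0 0, h0 0, g.one_isHom⟩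
    have h2 := hD.dec_smul h1 (κ x) i
    rw [← hκs, one_smul, zero_add] at h2
    refine ⟨(gD.dec (κ x) i).2, Prod.ext ?_ rfl⟩
    have h3 : (gD.dec (κ x) i).1 = (0 : A) • (gD.dec (κ x) i).1 := congrArg Prod.fst h2
    rw [zero_smul] at h3
    exact h3.symm
  refine ⟨gD.ofInjective ι hι hιr, gD.ofInjective κ hκ hκr, ?_, ?_, ?_⟩
  · intro i j r x hr hx
    rw [ZGrading.ofInjective_isHom_iff] at hx ⊢
    rw [hιs]
    exact hD (Tri.grading_isHom_iff.2 ⟨hr, h0 i, h0 i⟩) hx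
  · intro i j r x hr hx
    rw [ZGrading.ofInjective_isHom_iff] at hx ⊢
    rw [hκs]
    exact hD (Tri.grading_isHom_iff.2 ⟨h0 i, h0 i, hr⟩) hx
  · intro i x hx
    rw [ZGrading.ofInjective_isHom_iff] at hx ⊢
    -- The map `d` is the action of the matrix unit below the diagonal, which has degree zero.
    have h1 : κ (d.toAddMonoidHom x) = Tri.mk (0 : A) 1 0 • ι x := hd x
    rw [h1, add_comm]
    exact hD (Tri.grading_isHom_iff.2 ⟨h0 0, g.one_isHom, h0 0⟩) hx

end Arrow

end Triangular

/-! ### Homogeneous gradings for maps of projective modules -/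

section Presentations

variable {A : Type u} [Ring A] {g : RingZGrading A}

theorem exists_projective_range_eq_span {L : Type*} [AddCommGroup L] [Module A L]
    {gL : ZGrading L} (hL : g.IsModGrading gL) (t : Finset L)
    (ht : ∀ x ∈ t, ∃ i, gL.IsHom i x) :
    ∃ (Q : Type u) (_ : AddCommGroup Q) (_ : Module A Q) (gQ : ZGrading Q) (π : Q →ₗ[A] L),
      Module.Finite A Q ∧ Module.Projective A Q ∧ g.IsModGrading gQ ∧
      gQ.IsHomMap gL 0 π.toAddMonoidHom ∧ LinearMap.range π = Submodule.span A (t : Set L) := by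
  classical
  induction t using Finset.induction_on with
  | empty =>
    obtain ⟨gQ, hQ⟩ := RingZGrading.gradable_of_subsingleton (g := g) (M := PUnit.{u + 1})
    refine ⟨PUnit, inferInstance, inferInstance, gQ, 0, inferInstance, inferInstance, hQ, ?_, ?_⟩
    · intro i x _
      exact gL.isHom_zero _
    · simp
  | insert x t _ ih =>
    obtain ⟨Q, _, _, gQ, π, hfin, hproj, hQ, hπ, hr⟩ :=
      ih fun y hy => ht y (Finset.mem_insert_of_mem hy)
    obtain ⟨d, hd⟩ := ht x (Finset.mem_insert_self _ _)
    -- The new copy of `A` is shifted by the degree `d` of `x`, so that `1` has degree `d` and can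
    -- map to `x` homogeneously.
    refine ⟨Q × A, inferInstance, inferInstance, gQ.prod (g.toZGrading.shift d),
      π.coprod (LinearMap.toSpanSingleton A L x), inferInstance, inferInstance,
      hQ.prod (g.isModGrading_self.shift d), ?_, ?_⟩
    · intro i y hy
      obtain ⟨h1, h2⟩ := (ZGrading.prod_isHom_iff _ _ _ _).1 hy
      rw [ZGrading.shift_isHom_iff] at h2
      have h3 := hL h2 hd
      rw [sub_add_cancel] at h3
      have h4 := hπ i _ h1
      rw [add_zero] at h4 ⊢
      exact h4.add h3
    · rw [LinearMap.range_coprod, hr, LinearMap.range_toSpanSingleton, Finset.coe_insert,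
        Submodule.span_insert, sup_comm]

theorem exists_projective_surjective {L : Type*} [AddCommGroup L] [Module A L]
    [hfin : Module.Finite A L] {gL : ZGrading L} (hL : g.IsModGrading gL) :
    ∃ (Q : Type u) (_ : AddCommGroup Q) (_ : Module A Q) (gQ : ZGrading Q) (π : Q →ₗ[A] L),
      Module.Finite A Q ∧ Module.Projective A Q ∧ g.IsModGrading gQ ∧
      gQ.IsHomMap gL 0 π.toAddMonoidHom ∧ LinearMap.range π = ⊤ := by
  obtain ⟨s, hs⟩ := hfin.fg_top
  obtain ⟨t, ht, hst⟩ := gL.exists_finset_isHom (S := A) s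
  have : Submodule.span A (t : Set L) = ⊤ := by
    rw [eq_top_iff, ← hs]
    exact Submodule.span_le.2 hst
  rw [← this]
  exact exists_projective_range_eq_span hL t ht

theorem Module.Projective.exists_lift_of_range_le {P X Y : Type*} [AddCommGroup P] [Module A P]
    [AddCommGroup X] [Module A X] [AddCommGroup Y] [Module A Y] [Module.Projective A P]
    (v : Y →ₗ[A] X) (u : P →ₗ[A] X) (h : LinearMap.range u ≤ LinearMap.range v) :
    ∃ w : P →ₗ[A] Y, ∀ x, v (w x) = u x := by
  obtain ⟨w, hw⟩ := Module.projective_lifting_property v.rangeRestrict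
    (u.codRestrict (LinearMap.range v) fun x => h ⟨x, rfl⟩) v.surjective_rangeRestrict
  exact ⟨w, fun x => congrArg Subtype.val (LinearMap.congr_fun hw x)⟩

/-- If finitely generated modules are gradable, then maps between finitely generated
projective modules are homogeneous for suitable gradings. -/
theorem exists_grading_of_projective [IsArtinianRing A]
    (H : ∀ (L : Type u) [AddCommGroup L] [Module A L] [Module.Finite A L], g.Gradable L)
    {P₁ P₀ : Type u} [AddCommGroup P₁] [Module A P₁] [AddCommGroup P₀] [Module A P₀]
    [Module.Finite A P₁] [Module.Finite A P₀] [Module.Projective A P₁] [Module.Projective A P₀]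
    (f : P₁ →ₗ[A] P₀) :
    ∃ (g₁ : ZGrading P₁) (g₀ : ZGrading P₀), g.IsModGrading g₁ ∧ g.IsModGrading g₀ ∧
      g₁.IsHomMap g₀ 0 f.toAddMonoidHom := by
  let ν := (LinearMap.range f).mkQ
  obtain ⟨gN, hN⟩ := H (P₀ ⧸ LinearMap.range f)
  obtain ⟨Q₀, _, _, gQ₀, π, _, _, hQ₀, hπ, hπr⟩ := exists_projective_surjective hN
  have hK := hπ.isHomSub_ker
  obtain ⟨Q₁, _, _, gQ₁, π₁, _, _, hQ₁, hπ₁, hπ₁r⟩ :=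
    exists_projective_surjective (hK.isModGrading_subGrading hQ₀)
  let d : Q₁ →ₗ[A] Q₀ := (LinearMap.ker π).subtype ∘ₗ π₁
  have hd : gQ₁.IsHomMap gQ₀ 0 d.toAddMonoidHom := by
    intro i x hx
    exact hK.subGrading_isHom_iff.1 (hπ₁ i x hx)
  have hdr : LinearMap.range d = LinearMap.ker π := by
    rw [LinearMap.range_comp, hπ₁r, Submodule.map_top, Submodule.range_subtype]
  obtain ⟨gP, hP⟩ := H P₁
  obtain ⟨a₀, ha₀⟩ := Module.Projective.exists_lift_of_range_le π ν (by rw [hπr]; exact le_top)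
  obtain ⟨b₀, hb₀⟩ := Module.Projective.exists_lift_of_range_le ν π
    (by rw [Submodule.range_mkQ]; exact le_top)
  have hνf : ∀ x, ν (f x) = 0 := fun x =>
    (Submodule.Quotient.mk_eq_zero _).2 (LinearMap.mem_range_self f x)
  have hker : ∀ y, ν y = 0 → y ∈ LinearMap.range f := fun y hy =>
    (Submodule.Quotient.mk_eq_zero _).1 hy
  have hπd : ∀ x, π (d x) = 0 := fun x => by
    have : d x ∈ LinearMap.ker π := hdr ▸ LinearMap.mem_range_self d x
    exact this
  obtain ⟨a₁, ha₁⟩ := Module.Projective.exists_lift_of_range_le d (a₀ ∘ₗ f) (by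
    rintro _ ⟨x, rfl⟩
    rw [hdr, LinearMap.mem_ker, LinearMap.comp_apply, ha₀, hνf])
  obtain ⟨b₁, hb₁⟩ := Module.Projective.exists_lift_of_range_le f (b₀ ∘ₗ d) (by
    rintro _ ⟨x, rfl⟩
    refine hker _ ?_
    rw [LinearMap.comp_apply, hb₀, hπd])
  -- Comparison maps `a₀`, `a₁` and `b₀`, `b₁` between `f` and the graded presentation `d` cover the
  -- identity of the cokernel, so `b₀ ∘ₗ a₀` differs from the identity by `f ∘ₗ s`.
  obtain ⟨s, hs⟩ := Module.Projective.exists_lift_of_range_le f (LinearMap.id - b₀ ∘ₗ a₀) (by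
    rintro _ ⟨x, rfl⟩
    refine hker _ ?_
    rw [LinearMap.sub_apply, LinearMap.comp_apply, map_sub, hb₀, ha₀, LinearMap.id_apply,
      sub_self])
  let s₁ : P₁ →ₗ[A] P₁ := LinearMap.id - b₁ ∘ₗ a₁ - s ∘ₗ f
  have hs₁ : ∀ x, f (s₁ x) = 0 := fun x => by
    simp [s₁, hb₁, ha₁, hs]
  -- `D` is the direct sum of `d`, the identity of `P₁` and the map `P₁ → 0`. The second summand
  -- absorbs the homotopy `s`, the third the remaining error `s₁`, which has values in the kernel of
  -- `f`; thus `f` is a retract of `D`. It is homogeneous because `P₁` is gradable by `H`.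
  let D : (Q₁ × P₁ × P₁) →ₗ[A] Q₀ × P₁ := d.prodMap (LinearMap.fst A P₁ P₁)
  have hD : (gQ₁.prod (gP.prod gP)).IsHomMap (gQ₀.prod gP) 0 D.toAddMonoidHom := by
    intro i x hx
    obtain ⟨h1, h2⟩ := (ZGrading.prod_isHom_iff _ _ _ _).1 hx
    obtain ⟨h2, h3⟩ := (ZGrading.prod_isHom_iff _ _ _ _).1 h2
    refine (ZGrading.prod_isHom_iff _ _ _ _).2 ⟨hd i _ h1, ?_⟩
    rw [add_zero]
    exact h2
  have hgrad := Arrow.gradable (hQ₁.prod (hP.prod hP)) (hQ₀.prod hP) hD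
  refine Arrow.exists_grading (hgrad.of_retract
    (Arrow.map (d := f) (d' := D) (a₁.prod ((s ∘ₗ f).prod LinearMap.id)) (a₀.prod s) ?_)
    (Arrow.map (d := D) (d' := f) (b₁.coprod (LinearMap.id.coprod s₁)) (b₀.coprod f) ?_) ?_)
  · intro x
    simp [D, ha₁]
  · intro x
    simp [D, hb₁, hs₁]
  · intro x
    refine Prod.ext ?_ ?_
    · change b₁ (a₁ x.1) + (s (f x.1) + s₁ x.1) = x.1
      simp [s₁]
    · change b₀ (a₀ x.2) + f (s x.2) = x.2
      simp [hs]

end Presentations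

/-! ### Gradings of duals and the passage to the opposite ring -/

section Dual

variable {A : Type*} [Ring A] {g : RingZGrading A} {P L Q : Type*} [AddCommGroup P] [Module A P]
  [AddCommGroup L] [Module A L] [AddCommGroup Q] [Module A Q] {gP : ZGrading P} {gL : ZGrading L}
  {gQ : ZGrading Q}

namespace RingZGrading

theorem linearMap_ext_isHom {f f' : P →ₗ[A] L} (h : ∀ i x, gP.IsHom i x → f x = f' x) :
    f = f' :=
  LinearMap.toAddMonoidHom_injective (gP.addHom_ext h)

theorem degPart_add (hP : g.IsModGrading gP) (hL : g.IsModGrading gL) (k : ℤ)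
    (f f' : P →ₗ[A] L) : degPart hP hL k (f + f') = degPart hP hL k f + degPart hP hL k f' := by
  refine linearMap_ext_isHom (gP := gP) fun i x hx => ?_
  rw [LinearMap.add_apply, degPart_of_isHom _ _ _ hx, degPart_of_isHom _ _ _ hx,
    degPart_of_isHom _ _ _ hx, LinearMap.add_apply, map_add gL.dec, Finsupp.add_apply]

theorem degPart_zero (hP : g.IsModGrading gP) (hL : g.IsModGrading gL) (k : ℤ) :
    degPart hP hL k (0 : P →ₗ[A] L) = 0 := by
  refine linearMap_ext_isHom (gP := gP) fun i x hx => ?_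
  simp [degPart_of_isHom _ _ _ hx]

theorem degPart_comp (hP : g.IsModGrading gP) (hL : g.IsModGrading gL) (hQ : g.IsModGrading gQ)
    (k : ℤ) (h : Q →ₗ[A] L) {f : P →ₗ[A] Q} (hf : gP.IsHomMap gQ 0 f.toAddMonoidHom) :
    degPart hP hL k (h ∘ₗ f) = degPart hQ hL k h ∘ₗ f := by
  refine linearMap_ext_isHom (gP := gP) fun i x hx => ?_
  have := hf i x hx
  rw [add_zero] at this
  rw [degPart_of_isHom _ _ _ hx, LinearMap.comp_apply, LinearMap.comp_apply]
  exact (degPart_of_isHom hQ hL h this).symm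

theorem degPart_of_isHomMap (hP : g.IsModGrading gP) (hL : g.IsModGrading gL) {j : ℤ}
    {f : P →ₗ[A] L} (hf : gP.IsHomMap gL j f.toAddMonoidHom) (k : ℤ) :
    degPart hP hL k f = Finsupp.single j f k := by
  refine linearMap_ext_isHom (gP := gP) fun i x hx => ?_
  have h1 : gL.IsHom (i + j) (f x) := hf i x hx
  rw [degPart_of_isHom _ _ _ hx]
  by_cases h : k = j
  · rw [h, h1.dec_self, Finsupp.single_eq_same]
  · rw [h1.dec_of_ne (by omega), Finsupp.single_eq_of_ne h, LinearMap.zero_apply]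

/-- The grading of the group of linear maps between graded modules of finite support. -/
noncomputable def homGrading (hP : g.IsModGrading gP) (hL : g.IsModGrading gL) (F : Finset ℤ)
    (hF : ∀ (k : ℤ) (f : P →ₗ[A] L), degPart hP hL k f ≠ 0 → k ∈ F) : ZGrading (P →ₗ[A] L) where
  dec :=
    { toFun := fun f => Finsupp.onFinset F (fun k => degPart hP hL k f) fun k => hF k f
      map_zero' := by
        ext1 k
        exact degPart_zero hP hL k
      map_add' := fun f f' => by
        ext1 k
        exact degPart_add hP hL k f f' }
  dec_dec f i := by
    ext1 k
    exact degPart_of_isHomMap hP hL (isHomMap_degPart hP hL i f) k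
  sum_dec f := by
    refine linearMap_ext_isHom (gP := gP) fun i x hx => ?_
    simp only [AddMonoidHom.coe_mk, ZeroHom.coe_mk]
    rw [Finsupp.onFinset_sum _ (fun _ => rfl), LinearMap.sum_apply]
    simp only [degPart_of_isHom hP hL f hx]
    conv_rhs => rw [← gL.sum_dec (f x)]
    rw [Finsupp.sum_of_support_subset (s := F.map (addLeftEmbedding i)) _ _ _ (fun _ _ => rfl),
      Finset.sum_map]
    · rfl
    · intro l hl
      rw [Finsupp.mem_support_iff] at hl
      refine Finset.mem_map.2 ⟨l - i, hF _ f fun h0 => hl ?_, by simp⟩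
      have := LinearMap.congr_fun h0 x
      rw [degPart_of_isHom hP hL f hx, add_sub_cancel] at this
      exact this

theorem homGrading_isHom_iff (hP : g.IsModGrading gP) (hL : g.IsModGrading gL) (F : Finset ℤ)
    (hF : ∀ (k : ℤ) (f : P →ₗ[A] L), degPart hP hL k f ≠ 0 → k ∈ F) {k : ℤ} {f : P →ₗ[A] L} :
    (homGrading hP hL F hF).IsHom k f ↔ gP.IsHomMap gL k f.toAddMonoidHom := by
  constructor
  · intro h
    have h1 : degPart hP hL k f = f := h.dec_self
    rw [← h1]
    exact isHomMap_degPart hP hL k f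
  · intro h
    ext1 j
    exact degPart_of_isHomMap hP hL h j

theorem exists_degPart_support [IsArtinianRing A] [Module.Finite A P] [Module.Finite A L]
    (hP : g.IsModGrading gP) (hL : g.IsModGrading gL) :
    ∃ F : Finset ℤ, ∀ (k : ℤ) (f : P →ₗ[A] L), degPart hP hL k f ≠ 0 → k ∈ F := by
  classical
  obtain ⟨F₁, hF₁⟩ := exists_support hP
  obtain ⟨F₂, hF₂⟩ := exists_support hL
  refine ⟨(F₁ ×ˢ F₂).image fun x => x.2 - x.1, fun k f hk => ?_⟩
  by_contra hcon
  apply hk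
  refine linearMap_ext_isHom (gP := gP) fun i x hx => ?_
  rw [LinearMap.zero_apply]
  by_contra h0
  apply hcon
  have hx0 : x ≠ 0 := fun h => h0 (by rw [h, map_zero])
  exact Finset.mem_image.2 ⟨(i, i + k), Finset.mem_product.2
    ⟨hF₁ i x hx hx0, hF₂ (i + k) _ (isHomMap_degPart hP hL k f i x hx) h0⟩, by simp⟩

end RingZGrading

/-- If finitely generated modules over the graded left artinian ring `A` are gradable, then so are
the finitely presented modules over the opposite ring `B`. -/
theorem gradable_of_antiEquiv {A B : Type u} [Ring A] [Ring B] [IsArtinianRing A]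
    {gA : RingZGrading A} {gB : RingZGrading B}
    (H : ∀ (L : Type u) [AddCommGroup L] [Module A L] [Module.Finite A L], gA.Gradable L)
    (τ : A ≃+ B) (hτ : ∀ x y, τ (x * y) = τ y * τ x)
    (hgτ : ∀ i a, gA.IsHom i a ↔ gB.IsHom i (τ a))
    (M : Type v) [AddCommGroup M] [Module B M] [Module.FinitePresentation B M] :
    gB.Gradable M := by
  classical
  obtain ⟨m, p, hp⟩ := Module.Finite.exists_fin' B M
  obtain ⟨n, ρ, hρ⟩ := Submodule.fg_iff_exists_fin_generating_family.1
    (Module.FinitePresentation.fg_ker p hp)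
  let bm := Pi.basisFun A (Fin m)
  let bn := Pi.basisFun A (Fin n)
  -- The matrix of relations of `M`, transported by `τ`, is read as a map in the opposite direction.
  -- Its dual is the original presentation, so `M` is the cokernel of `h ↦ h ∘ₗ f`.
  let f : (Fin m → A) →ₗ[A] (Fin n → A) := bm.constr ℕ fun l j => τ.symm (ρ j l)
  have hf : ∀ l, f (bm l) = ∑ j, τ.symm (ρ j l) • bn j := fun l => by
    rw [Module.Basis.constr_basis]
    exact (bn.sum_repr fun j => τ.symm (ρ j l)).symm
  -- These are gradings of the free modules adapted to `f`; the standard bases need not be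
  -- homogeneous.
  obtain ⟨g₁, g₀, hg₁, hg₀, hfh⟩ := exists_grading_of_projective H f
  have hAA := gA.isModGrading_self
  obtain ⟨F, hF⟩ := RingZGrading.exists_degPart_support hg₁ hAA
  let gH := RingZGrading.homGrading hg₁ hAA F hF
  let Φ : ((Fin m → A) →ₗ[A] A) →+ (Fin m → B) :=
    { toFun := fun h l => τ (h (bm l))
      map_zero' := by ext l; simp
      map_add' := fun h h' => by ext l; simp }
  have hΦ : ∀ h l, Φ h l = τ (h (bm l)) := fun h l => rfl
  have hΦinj : Function.Injective Φ := fun h h' heq =>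
    bm.ext fun l => τ.injective (congrFun heq l)
  have hΦsurj : Function.Surjective Φ := fun y =>
    ⟨bm.constr ℕ fun l => τ.symm (y l), by
      ext l
      rw [hΦ, Module.Basis.constr_basis, AddEquiv.apply_symm_apply]⟩
  have hΦf : ∀ h : (Fin n → A) →ₗ[A] A, Φ (h ∘ₗ f) = ∑ j, τ (h (bn j)) • ρ j := by
    intro h
    ext l
    rw [hΦ, LinearMap.comp_apply, hf, map_sum, map_sum, Finset.sum_apply]
    refine Finset.sum_congr rfl fun j _ => ?_
    rw [map_smul, smul_eq_mul, hτ, AddEquiv.apply_symm_apply]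
    rfl
  let ψ : ((Fin m → A) →ₗ[A] A) →+ M := p.toAddMonoidHom.comp Φ
  have hψsurj : Function.Surjective ψ := hp.comp hΦsurj
  have hψf : ∀ h : (Fin n → A) →ₗ[A] A, ψ (h ∘ₗ f) = 0 := by
    intro h
    have : Φ (h ∘ₗ f) ∈ LinearMap.ker p := by
      rw [hΦf, ← hρ]
      exact Submodule.sum_mem _ fun j _ => Submodule.smul_mem _ _ (Submodule.subset_span ⟨j, rfl⟩)
    exact this
  have hψker : ∀ h, ψ h = 0 → ∃ h' : (Fin n → A) →ₗ[A] A, h = h' ∘ₗ f := by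
    intro h hh
    have : Φ h ∈ LinearMap.ker p := hh
    rw [← hρ] at this
    obtain ⟨c, hc⟩ := (Submodule.mem_span_range_iff_exists_fun B).1 this
    refine ⟨bn.constr ℕ fun j => τ.symm (c j), hΦinj ?_⟩
    rw [hΦf, ← hc]
    simp only [Module.Basis.constr_basis, AddEquiv.apply_symm_apply]
  have hker : ∀ h, ψ h = 0 → ∀ i, ψ (gH.dec h i) = 0 := by
    intro h hh i
    obtain ⟨h', rfl⟩ := hψker h hh
    -- As `f` has degree zero, the components of a map that factors through `f` also factor through
    -- it, which makes the kernel of `ψ` homogeneous.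
    have : gH.dec (h' ∘ₗ f) i = RingZGrading.degPart hg₀ hAA i h' ∘ₗ f :=
      RingZGrading.degPart_comp hg₁ hAA hg₀ i h' hfh
    rw [this, hψf]
  refine ⟨gH.ofSurjective ψ hψsurj hker, ?_⟩
  intro i j r x hr hx
  obtain ⟨h, rfl⟩ := hψsurj x
  rw [← hx.dec_self, ZGrading.ofSurjective_dec]
  have hh : g₁.IsHomMap gA.toZGrading j (gH.dec h j).toAddMonoidHom :=
    (RingZGrading.homGrading_isHom_iff hg₁ hAA F hF).1 (gH.isHom_dec h j)
  generalize gH.dec h j = h₁ at hh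
  have ha : gA.IsHom i (τ.symm r) := (hgτ _ _).2 (by rwa [AddEquiv.apply_symm_apply])
  -- Under `Φ` the action of `r` on `Fin m → B` becomes right multiplication by `τ.symm r` on the
  -- values of a map, which raises its degree by `i`.
  let h₂ : (Fin m → A) →ₗ[A] A := LinearMap.toSpanSingleton A A (τ.symm r) ∘ₗ h₁
  have h₂h : g₁.IsHomMap gA.toZGrading (i + j) h₂.toAddMonoidHom := by
    intro k y hy
    rw [add_comm i j, ← add_assoc]
    exact gA.mul_isHom (hh k y hy) ha
  have heq : r • ψ h₁ = ψ h₂ := by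
    have : Φ h₂ = r • Φ h₁ := by
      ext l
      rw [hΦ, Pi.smul_apply, hΦ, smul_eq_mul]
      change τ (h₁ (bm l) * τ.symm r) = _
      rw [hτ, AddEquiv.apply_symm_apply]
    change r • p (Φ h₁) = p (Φ h₂)
    rw [this, map_smul]
  rw [heq]
  have := gH.ofSurjective_isHomMap ψ hψsurj hker _ _
    ((RingZGrading.homGrading_isHom_iff hg₁ hAA F hF).2 h₂h)
  rwa [add_zero] at this

end Dual

/-! ### Graded rings, opposite rings and the theorem -/

section Main

variable {R : Type u} [Ring R] (𝒜 : ℤ → AddSubgroup R) [GradedRing 𝒜]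

/-- The grading of a graded ring, as a `RingZGrading`. -/
noncomputable def RingZGrading.ofGradedRing : RingZGrading R where
  toZGrading := ZGrading.ofDecomposition 𝒜
  one_isHom := (ZGrading.ofDecomposition_isHom_iff 𝒜 _ _).2 SetLike.GradedOne.one_mem
  mul_isHom hx hy := (ZGrading.ofDecomposition_isHom_iff 𝒜 _ _).2
    (SetLike.GradedMul.mul_mem ((ZGrading.ofDecomposition_isHom_iff 𝒜 _ _).1 hx)
      ((ZGrading.ofDecomposition_isHom_iff 𝒜 _ _).1 hy))

theorem RingZGrading.ofGradedRing_isHom_iff {i : ℤ} {r : R} :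
    (RingZGrading.ofGradedRing 𝒜).IsHom i r ↔ r ∈ 𝒜 i :=
  ZGrading.ofDecomposition_isHom_iff 𝒜 i r

theorem ZGrading.op_exists (g : ZGrading R) (x : Rᵐᵒᵖ) (i : ℤ) :
    ∃ y, (MulOpposite.opAddEquiv.symm : Rᵐᵒᵖ ≃+ R).toAddMonoidHom y =
      g.dec ((MulOpposite.opAddEquiv.symm : Rᵐᵒᵖ ≃+ R).toAddMonoidHom x) i :=
  ⟨MulOpposite.op _, rfl⟩

/-- The grading of the opposite group. -/
noncomputable def ZGrading.op (g : ZGrading R) : ZGrading Rᵐᵒᵖ :=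
  g.ofInjective (MulOpposite.opAddEquiv.symm : Rᵐᵒᵖ ≃+ R).toAddMonoidHom
    MulOpposite.unop_injective g.op_exists

theorem ZGrading.op_isHom_iff (g : ZGrading R) {i : ℤ} {r : Rᵐᵒᵖ} :
    g.op.IsHom i r ↔ g.IsHom i r.unop :=
  g.ofInjective_isHom_iff (MulOpposite.opAddEquiv.symm : Rᵐᵒᵖ ≃+ R).toAddMonoidHom
    MulOpposite.unop_injective g.op_exists r i

/-- The grading of the opposite ring. -/
noncomputable def RingZGrading.op (g : RingZGrading R) : RingZGrading Rᵐᵒᵖ where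
  toZGrading := g.toZGrading.op
  one_isHom := g.toZGrading.op_isHom_iff.2 g.one_isHom
  mul_isHom {i j x y} hx hy := by
    refine g.toZGrading.op_isHom_iff.2 ?_
    rw [add_comm i j]
    exact g.mul_isHom (g.toZGrading.op_isHom_iff.1 hy) (g.toZGrading.op_isHom_iff.1 hx)

theorem RingZGrading.op_isHom_iff (g : RingZGrading R) {i : ℤ} {r : Rᵐᵒᵖ} :
    g.op.IsHom i r ↔ g.IsHom i r.unop :=
  g.toZGrading.op_isHom_iff

theorem RingZGrading.Gradable.isLeftGradable {N : Type v} [AddCommGroup N] [Module R N]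
    (h : (RingZGrading.ofGradedRing 𝒜).Gradable N) : IsLeftGradable 𝒜 N := by
  obtain ⟨gN, hN⟩ := h
  refine ⟨N, inferInstance, inferInstance, gN.component, ⟨gN.isInternal_component, ?_⟩,
    ⟨LinearEquiv.refl R N⟩⟩
  intro i j r m hr hm
  exact hN ((RingZGrading.ofGradedRing_isHom_iff 𝒜).2 hr) hm

theorem RingZGrading.Gradable.isRightGradable {N : Type v} [AddCommGroup N] [Module Rᵐᵒᵖ N]
    (h : (RingZGrading.ofGradedRing 𝒜).op.Gradable N) : IsRightGradable 𝒜 N := by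
  obtain ⟨gN, hN⟩ := h
  refine ⟨N, inferInstance, inferInstance, gN.component, ⟨gN.isInternal_component, ?_⟩,
    ⟨LinearEquiv.refl Rᵐᵒᵖ N⟩⟩
  intro i j m r hm hr
  rw [add_comm]
  exact hN ((RingZGrading.op_isHom_iff _).2 ((RingZGrading.ofGradedRing_isHom_iff 𝒜).2 hr)) hm

end Main

theorem mainTheorem6 {R : Type u} [Ring R] (𝒜 : ℤ → AddSubgroup R) [GradedRing 𝒜] :
    ((IsRightPureSemisimple R ∨ IsLeftPureSemisimple R) →
      (∀ (N : Type v) [AddCommGroup N] [Module Rᵐᵒᵖ N],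
        Module.FinitePresentation Rᵐᵒᵖ N → IsRightGradable 𝒜 N) ∧
      (∀ (N : Type v) [AddCommGroup N] [Module R N],
        Module.FinitePresentation R N → IsLeftGradable 𝒜 N)) ∧
    (IsRightPureSemisimple R →
      ∀ (N : Type v) [AddCommGroup N] [Module Rᵐᵒᵖ N],
        Module.Finite Rᵐᵒᵖ N → IsRightGradable 𝒜 N) := by
  let g := RingZGrading.ofGradedRing 𝒜
  -- The two notions are definitionally the same, so the left-handed results apply to `Rᵐᵒᵖ`.
  have hright : IsRightPureSemisimple R → IsLeftPureSemisimple Rᵐᵒᵖ := fun h => h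
  refine ⟨?_, fun h N _ _ _ => ((hright h).gradable g.op N).isRightGradable⟩
  rintro (h | h)
  · replace h := hright h
    have := h.isArtinianRing
    refine ⟨fun N _ _ _ => (h.gradable g.op N).isRightGradable, fun N _ _ _ => ?_⟩
    exact (gradable_of_antiEquiv (gA := g.op) (gB := g) (fun L _ _ _ => h.gradable g.op L)
      (MulOpposite.opAddEquiv.symm : Rᵐᵒᵖ ≃+ R) (fun x y => rfl)
      (fun i a => g.op_isHom_iff) N).isLeftGradable
  · have := h.isArtinianRing
    refine ⟨fun N _ _ _ => ?_, fun N _ _ _ => (h.gradable g N).isLeftGradable⟩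
    exact (gradable_of_antiEquiv (gA := g) (gB := g.op) (fun L _ _ _ => h.gradable g L)
      (MulOpposite.opAddEquiv : R ≃+ Rᵐᵒᵖ) (fun x y => rfl)
      (fun i a => (g.op_isHom_iff (r := MulOpposite.op a)).symm) N).isRightGradable
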